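/- Let $R$ be a Dedekind domain with field of fractions $K$, let $(A,d)$ be a differential graded (dg) $K$-algebra which is semisimple artinian as an algebra, and let $(\Lambda,d)$ be a dg $R$-order in $(A,d)$, i.e. $\Lambda\subseteq A$ is a graded $R$-subalgebra, stable under $d$, finitely generated and projective over $R$, with $K\Lambda=A$. For a nonzero prime $\wp$ of $R$ let $\widehat A_\wp=\widehat K_\wp\otimes_K A$ (with the induced grading and differential) and $\widehat\Lambda_\wp=\widehat R_\wp\Lambda\subseteq\widehat A_\wp$. Let $\widehat J(A,d)$ be the group of families $\alpha=(\alpha(\wp))_\wp$ of homogeneous elements $\alpha(\wp)\in\widehat A_\wp^\times\cap\ker d$ such that $\alpha(\wp)\in\widehat\Lambda_\wp^\times$ for almost all $\wp$; let $\widehat U(\Lambda,d)$ be the subgroup of the $\alpha$ with $\alpha(\wp)\in\widehat\Lambda_\wp^\times$ for all $\wp$. The completion dg idèles of $(\Lambda,d)$ are the classes in $\widehat U(\Lambda,d)\backslash\widehat J(A,d)/(A^\times\cap\ker d)$, where the homogeneous elements of $A^\times\cap\ker d$ are embedded diagonally. For $\alpha\in\widehat J(A,d)$ put $\Lambda\alpha=A\cap\bigcap_\wp\widehat\Lambda_\wp\alpha(\wp)$,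 a dg $(\Lambda,d)$-module. A finitely generated dg $(\Lambda,d)$-module $L$ is locally degree-$0$-free of rank one if $L_\wp\simeq(\Lambda_\wp,d_\wp)$ as dg-modules over $(\Lambda_\wp,d_\wp)$ for every prime $\wp$ of $R$ (localisation). Let $(\Lambda,d)\text{-}LF_0\text{-}dgmod$ be the full subcategory of dg $(\Lambda,d)$-modules consisting of the finite direct sums of such modules, and let $G_0((\Lambda,d)\text{-}LF_0\text{-}dgmod)$ be the free abelian group on its isomorphism classes modulo the relations $[X]-[Y]-[Z]$ for all short exact sequences $0\to Y\to X\to Z\to 0$ of dg-modules with $X,Y,Z$ in the subcategory. Let $Cl(\Lambda,d)$ be the subgroup of $G_0$ generated by the elements $[L]-[\Lambda]$ for $L$ an $R$-projective locally degree-$0$-free dg-module of rank one. Theorem. For every $\alpha\in\widehat J(A,d)$ the dg-module $\Lambda\alpha$ is locally degree-$0$-free of rank one, and for all $\alpha,\beta\in\widehat J(A,d)$ $$[\Lambda\alpha]+[\Lambda\beta]-2[\Lambda]=[\Lambda\alpha\beta]-[\Lambda]\quad\text{in } G_0((\Lambda,d)\text{-}LF_0\text{-}dgmod).$$ Consequently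 $\Phi(\alpha)=[\Lambda\alpha]-[\Lambda]$ defines a surjective group homomorphism $\Phi:\widehat J(A,d)\to Cl(\Lambda,d)$, and $\Phi$ factors through the set $\widehat U(\Lambda,d)\backslash\widehat J(A,d)/(A^\times\cap\ker d)$ of completion dg idèles. -/

import Mathlib

open scoped TensorProduct DirectSum
open IsDedekindDomain

universe u v w

set_option linter.unusedSectionVars false

noncomputable section

/-! ### Differential graded algebras -/

/-- A differential graded `R`-algebra structure on an `R`-algebra `B`: a `ℤ`-grading
`B = ⨁ gr i` as an `R`-algebra and an `R`-linear differential `d` of degree `1` and square `0`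
with `d (a b) = d a * b + (-1)^|a| a * d b` for homogeneous `a`. -/
structure DGAlgebra (R : Type u) (B : Type w) [CommRing R] [Ring B] [Algebra R B] where
  gr : ℤ → Submodule R B
  gradedAlgebra : GradedAlgebra gr
  d : B →ₗ[R] B
  d_mem : ∀ (i : ℤ) (a : B), a ∈ gr i → d a ∈ gr (i + 1)
  d_d : ∀ a : B, d (d a) = 0
  leibniz : ∀ (i : ℤ) (a b : B), a ∈ gr i →
    d (a * b) = d a * b + Int.negOnePow i • (a * d b)

attribute [instance] DGAlgebra.gradedAlgebra

/-- A homogeneous submodule of a graded module is graded by its intersections with the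
homogeneous components. -/
lemma isInternal_of_homogeneous {S R V : Type*} [CommRing S] [CommRing R] [AddCommGroup V]
    [Module S V] [Module R V] [SMul R S] [IsScalarTower R S V]
    (gr : ℤ → Submodule S V) [DirectSum.Decomposition gr] (N : Submodule R V)
    (hN : DirectSum.SetLike.IsHomogeneous gr N) :
    DirectSum.IsInternal (fun i => ((gr i).restrictScalars R).comap N.subtype) := by
  have key : ∀ (y : ⨁ i, ((gr i).restrictScalars R).comap N.subtype) (i : ℤ),
      (DirectSum.decompose gr ((DirectSum.coeAddMonoidHom
        (fun i => ((gr i).restrictScalars R).comap N.subtype) y : N) : V) i : V)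
        = ((y i : N) : V) := by
    intro y
    induction y using DirectSum.induction_on with
    | zero => intro i; simp
    | of j x =>
      intro i
      obtain ⟨x, hx⟩ := x
      have hx' : (x : V) ∈ gr j := hx
      rw [DirectSum.coeAddMonoidHom_of]
      by_cases h : j = i
      · subst h
        simp [DirectSum.decompose_of_mem_same gr hx']
      · rw [DirectSum.decompose_of_mem_ne gr hx' h, DirectSum.of_eq_of_ne _ _ _ (Ne.symm h)]
        simp
    | add x y hx hy => intro i; simp [hx i, hy i]
  refine ⟨?_, ?_⟩
  · intro x y hxy
    refine DFinsupp.ext fun i => ?_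
    apply Subtype.ext
    apply Subtype.ext
    rw [← key x i, ← key y i, hxy]
  · intro x
    classical
    refine ⟨∑ i ∈ (DirectSum.decompose gr (x : V)).support,
      DirectSum.of (fun i => ((gr i).restrictScalars R).comap N.subtype) i
        ⟨⟨DirectSum.decompose gr (x : V) i, hN i x.2⟩,
          (DirectSum.decompose gr (x : V) i).2⟩, ?_⟩
    apply Subtype.ext
    rw [map_sum]
    simp only [DirectSum.coeAddMonoidHom_of]
    rw [AddSubmonoidClass.coe_finsetSum]
    exact DirectSum.sum_support_decompose gr (x : V)

namespace DGAlgebra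

section Basic

variable {R : Type u} {B : Type w} [CommRing R] [Ring B] [Algebra R B] (D : DGAlgebra R B)

lemma d_one : D.d 1 = 0 := by
  have h := D.leibniz 0 1 1 (SetLike.GradedOne.one_mem)
  simpa using h

/-- Multiplying by a cycle on the right commutes with the differential. -/
lemma d_mul_of_cycle (a b : B) (hb : D.d b = 0) : D.d (a * b) = D.d a * b := by
  induction a using DirectSum.Decomposition.inductionOn D.gr with
  | zero => simp
  | homogeneous m => rw [D.leibniz _ _ _ m.2, hb]; simp
  | add m m' h h' => rw [add_mul, map_add, h, h', map_add, add_mul]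

/-- The group `B^× ∩ ker d` of homogeneous units which are cycles. -/
def cycleUnits : Subgroup Bˣ where
  carrier := {x | SetLike.IsHomogeneousElem D.gr (x : B) ∧ D.d (x : B) = 0}
  one_mem' := ⟨⟨0, by simpa using SetLike.GradedOne.one_mem (A := D.gr)⟩, by simpa using D.d_one⟩
  mul_mem' := by
    rintro x y ⟨⟨i, hi⟩, hx⟩ ⟨⟨j, hj⟩, hy⟩
    refine ⟨⟨i + j, by simpa using SetLike.GradedMul.mul_mem hi hj⟩, ?_⟩
    rw [Units.val_mul, D.d_mul_of_cycle _ _ hy, hx, zero_mul]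
  inv_mem' := by
    rintro x ⟨⟨i, hi⟩, hx⟩
    have hinv : D.d ((x⁻¹ : Bˣ) : B) = 0 := by
      have h := D.d_mul_of_cycle ((x⁻¹ : Bˣ) : B) (x : B) hx
      rw [Units.inv_mul, D.d_one] at h
      have := congrArg (· * ((x⁻¹ : Bˣ) : B)) h
      simpa [mul_assoc] using this.symm
    refine ⟨⟨-i, ?_⟩, hinv⟩
    have h := DirectSum.coe_decompose_mul_add_of_left_mem D.gr (i := i) (j := -i)
      (b := ((x⁻¹ : Bˣ) : B)) hi
    rw [Units.mul_inv, add_neg_cancel,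
      DirectSum.decompose_of_mem_same D.gr (SetLike.GradedOne.one_mem)] at h
    have h2 : ((x⁻¹ : Bˣ) : B) =
        (DirectSum.decompose D.gr ((x⁻¹ : Bˣ) : B) (-i) : B) := by
      have := congrArg (((x⁻¹ : Bˣ) : B) * ·) h
      simpa using this
    rw [h2]
    exact SetLike.coe_mem _

end Basic

section BaseChange

variable {R : Type u} {B : Type w} [CommRing R] [Ring B] [Algebra R B] (D : DGAlgebra R B)
  (S : Type v) [CommRing S] [Algebra R S]

/-- The dg-algebra `(S ⊗ B, id ⊗ d)` over `S`. -/
def baseChange : DGAlgebra S (S ⊗[R] B) where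
  gr i := (D.gr i).baseChange S
  gradedAlgebra := inferInstance
  d := D.d.baseChange S
  d_mem i a ha := by
    rw [Submodule.baseChange_eq_span] at ha
    induction ha using Submodule.span_induction with
    | mem x hx =>
      obtain ⟨y, hy, rfl⟩ := hx
      exact Submodule.tmul_mem_baseChange_of_mem _ (D.d_mem i y hy)
    | zero => simp
    | add x y _ _ hx hy => rw [map_add]; exact add_mem hx hy
    | smul s x _ hx => rw [map_smul]; exact Submodule.smul_mem _ _ hx
  d_d a := by
    induction a using TensorProduct.induction_on with
    | zero => simp
    | tmul s x => simp [D.d_d]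
    | add x y hx hy => simp [hx, hy]
  leibniz i a b ha := by
    rw [Submodule.baseChange_eq_span] at ha
    induction ha using Submodule.span_induction with
    | mem x hx =>
      obtain ⟨y, hy, rfl⟩ := hx
      induction b using TensorProduct.induction_on with
      | zero => simp
      | tmul s z =>
        have hy' : y ∈ D.gr i := hy
        simp only [TensorProduct.mk_apply, Algebra.TensorProduct.tmul_mul_tmul, one_mul,
          LinearMap.baseChange_tmul, D.leibniz i y z hy', TensorProduct.tmul_add]
        congr 1
        rcases Int.even_or_odd i with h | h
        · simp [Int.negOnePow_even _ h]
        · simp [Int.negOnePow_odd _ h, TensorProduct.tmul_neg]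
      | add x z hx hz =>
        simp only [mul_add, map_add, hx, hz, smul_add]
        abel
    | zero => simp
    | add x y _ _ hx hy =>
      simp only [add_mul, map_add, hx, hy, smul_add]
      abel
    | smul s x _ hx =>
      simp only [smul_mul_assoc, map_smul, hx, smul_add, smul_comm s]

lemma decompose_baseChange_tmul (b : B) (i : ℤ) :
    (DirectSum.decompose (D.baseChange S).gr ((1 : S) ⊗ₜ[R] b) i : S ⊗[R] B) =
      (1 : S) ⊗ₜ[R] (DirectSum.decompose D.gr b i : B) := by
  induction b using DirectSum.Decomposition.inductionOn D.gr with
  | zero => simp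
  | @homogeneous j m =>
    have hm : (1 : S) ⊗ₜ[R] (m : B) ∈ (D.baseChange S).gr j :=
      Submodule.tmul_mem_baseChange_of_mem _ m.2
    by_cases h : j = i
    · subst h
      rw [DirectSum.decompose_of_mem_same _ hm, DirectSum.decompose_of_mem_same _ m.2]
    · rw [DirectSum.decompose_of_mem_ne _ hm h, DirectSum.decompose_of_mem_ne _ m.2 h,
        TensorProduct.tmul_zero]
  | add m m' h h' =>
    simp only [TensorProduct.tmul_add, DirectSum.decompose_add, DirectSum.add_apply,
      Submodule.coe_add, h, h']

end BaseChange

end DGAlgebra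

/-! ### Differential graded modules -/

/-- Differential graded left modules over a dg-algebra `(B, d)`. -/
structure DGMod {R : Type u} {B : Type w} [CommRing R] [Ring B] [Algebra R B]
    (D : DGAlgebra R B) where
  carrier : Type w
  [addCommGroup : AddCommGroup carrier]
  [moduleBase : Module R carrier]
  [module : Module B carrier]
  [isScalarTower : IsScalarTower R B carrier]
  gr : ℤ → Submodule R carrier
  decomposition : DirectSum.Decomposition gr
  smul_mem : ∀ (i j : ℤ) (a : B) (m : carrier), a ∈ D.gr i → m ∈ gr j → a • m ∈ gr (i + j)
  d : carrier →ₗ[R] carrier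
  d_mem : ∀ (i : ℤ) (m : carrier), m ∈ gr i → d m ∈ gr (i + 1)
  d_d : ∀ m : carrier, d (d m) = 0
  leibniz : ∀ (i : ℤ) (a : B) (m : carrier), a ∈ D.gr i →
    d (a • m) = D.d a • m + Int.negOnePow i • (a • d m)

attribute [instance] DGMod.addCommGroup DGMod.moduleBase DGMod.module DGMod.isScalarTower
  DGMod.decomposition

namespace DGMod

variable {R : Type u} {B : Type w} [CommRing R] [Ring B] [Algebra R B] {D : DGAlgebra R B}

/-- Homomorphisms of dg-modules: `B`-linear, homogeneous of degree `0`, commuting with the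
differentials. -/
structure Hom (M N : DGMod D) where
  toLinearMap : M.carrier →ₗ[B] N.carrier
  map_gr : ∀ (i : ℤ) (m : M.carrier), m ∈ M.gr i → toLinearMap m ∈ N.gr i
  map_d : ∀ m : M.carrier, toLinearMap (M.d m) = N.d (toLinearMap m)

/-- Two dg-modules are isomorphic if there are mutually inverse homomorphisms. -/
def Isomorphic (M N : DGMod D) : Prop :=
  ∃ (f : Hom M N) (g : Hom N M), (∀ m, g.toLinearMap (f.toLinearMap m) = m) ∧
    ∀ n, f.toLinearMap (g.toLinearMap n) = n

lemma Isomorphic.refl (M : DGMod D) : Isomorphic M M :=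
  ⟨⟨LinearMap.id, fun _ _ h => h, fun _ => rfl⟩, ⟨LinearMap.id, fun _ _ h => h, fun _ => rfl⟩,
    fun _ => rfl, fun _ => rfl⟩

lemma Isomorphic.symm {M N : DGMod D} (h : Isomorphic M N) : Isomorphic N M := by
  obtain ⟨f, g, h1, h2⟩ := h
  exact ⟨g, f, h2, h1⟩

lemma Isomorphic.trans {M N P : DGMod D} (h : Isomorphic M N) (h' : Isomorphic N P) :
    Isomorphic M P := by
  obtain ⟨f, g, h1, h2⟩ := h
  obtain ⟨f', g', h1', h2'⟩ := h'
  refine ⟨⟨f'.toLinearMap ∘ₗ f.toLinearMap, fun i m hm => f'.map_gr i _ (f.map_gr i m hm),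
    fun m => by simp [f.map_d, f'.map_d]⟩, ⟨g.toLinearMap ∘ₗ g'.toLinearMap,
    fun i m hm => g.map_gr i _ (g'.map_gr i m hm), fun m => by simp [g.map_d, g'.map_d]⟩, ?_, ?_⟩
  · intro m; simp [h1, h1']
  · intro m; simp [h2, h2']

/-- There is a short exact sequence `0 → Y → X → Z → 0` of dg-modules. -/
def HasShortExact (Y X Z : DGMod D) : Prop :=
  ∃ (f : Hom Y X) (g : Hom X Z), Function.Injective f.toLinearMap ∧
    Function.Exact f.toLinearMap g.toLinearMap ∧ Function.Surjective g.toLinearMap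

/-- `X` is the direct sum of the finite family `L` of dg-modules (with componentwise grading and
differential). -/
def IsDirectSum (X : DGMod D) {n : ℕ} (L : Fin n → DGMod D) : Prop :=
  ∃ e : X.carrier ≃ₗ[B] (∀ k, (L k).carrier),
    (∀ (i : ℤ) (x : X.carrier), x ∈ X.gr i ↔ ∀ k, e x k ∈ (L k).gr i) ∧
    ∀ (x : X.carrier) (k : Fin n), e (X.d x) k = (L k).d (e x k)

variable (D) in
/-- The regular left dg-module `(B, d)`. -/
def regular : DGMod D where
  carrier := B
  gr := D.gr
  decomposition := inferInstance
  smul_mem _ _ _ _ ha hm := SetLike.GradedMul.mul_mem ha hm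
  d := D.d
  d_mem := D.d_mem
  d_d := D.d_d
  leibniz := D.leibniz

section BaseChange

variable (S : Type v) [CommRing S] [Algebra R S] (M : DGMod D)

/-- The action of `S ⊗ B` on `S ⊗ M`. -/
def baseChangeAction : S ⊗[R] B →ₐ[S] Module.End S (S ⊗[R] M.carrier) :=
  AlgHom.liftEquiv R S B _
    ((Module.End.baseChangeHom R S M.carrier).comp (Algebra.lsmul R R M.carrier))

@[simp]
lemma baseChangeAction_tmul (s t : S) (b : B) (m : M.carrier) :
    M.baseChangeAction S (s ⊗ₜ b) (t ⊗ₜ m) = (s * t) ⊗ₜ (b • m) := by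
  change s • (t ⊗ₜ[R] (b • m)) = _
  rw [TensorProduct.smul_tmul', smul_eq_mul]

/-- The dg-module `(S ⊗ M, id ⊗ d)` over `(S ⊗ B, id ⊗ d)`. -/
def baseChange : DGMod (D.baseChange S) :=
  letI : Module (S ⊗[R] B) (S ⊗[R] M.carrier) :=
    Module.compHom _ (M.baseChangeAction S).toRingHom
  have smul_def : ∀ (x : S ⊗[R] B) (y : S ⊗[R] M.carrier),
    x • y = M.baseChangeAction S x y := fun _ _ => rfl
  { carrier := S ⊗[R] M.carrier
    isScalarTower := ⟨fun s x y => by rw [smul_def, smul_def, map_smul]; rfl⟩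
    gr := fun i => (M.gr i).baseChange S
    decomposition := inferInstance
    smul_mem := fun i j a m ha hm => by
      have ha' : a ∈ (D.gr i).baseChange S := ha
      rw [Submodule.baseChange_eq_span] at ha' hm
      rw [smul_def]
      clear ha
      induction ha' using Submodule.span_induction with
      | mem x hx =>
        obtain ⟨y, hy, rfl⟩ := hx
        induction hm using Submodule.span_induction with
        | mem x hx =>
          obtain ⟨z, hz, rfl⟩ := hx
          simp only [TensorProduct.mk_apply, baseChangeAction_tmul, mul_one]
          exact Submodule.tmul_mem_baseChange_of_mem _ (M.smul_mem i j y z hy hz)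
        | zero => simp
        | add x y _ _ hx hy => rw [map_add]; exact add_mem hx hy
        | smul s x _ hx => rw [map_smul]; exact Submodule.smul_mem _ _ hx
      | zero => simp
      | add x y _ _ hx hy => rw [map_add]; exact add_mem hx hy
      | smul s x _ hx => rw [map_smul]; exact Submodule.smul_mem _ _ hx
    d := M.d.baseChange S
    d_mem := fun i a ha => by
      rw [Submodule.baseChange_eq_span] at ha
      induction ha using Submodule.span_induction with
      | mem x hx =>
        obtain ⟨y, hy, rfl⟩ := hx
        exact Submodule.tmul_mem_baseChange_of_mem _ (M.d_mem i y hy)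
      | zero => simp
      | add x y _ _ hx hy => rw [map_add]; exact add_mem hx hy
      | smul s x _ hx => rw [map_smul]; exact Submodule.smul_mem _ _ hx
    d_d := fun a => by
      induction a using TensorProduct.induction_on with
      | zero => simp
      | tmul s x => simp [M.d_d]
      | add x y hx hy => simp [hx, hy]
    leibniz := fun i a b ha => by
      have ha' : a ∈ (D.gr i).baseChange S := ha
      rw [Submodule.baseChange_eq_span] at ha'
      simp only [smul_def, DGAlgebra.baseChange]
      clear ha
      induction ha' using Submodule.span_induction with
      | mem x hx =>
        obtain ⟨y, hy, rfl⟩ := hx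
        induction b using TensorProduct.induction_on with
        | zero => simp
        | tmul s z =>
          have hy' : y ∈ D.gr i := hy
          simp only [TensorProduct.mk_apply, baseChangeAction_tmul, one_mul,
            LinearMap.baseChange_tmul, M.leibniz i y z hy', TensorProduct.tmul_add]
          congr 1
          rcases Int.even_or_odd i with h | h
          · simp [Int.negOnePow_even _ h]
          · simp [Int.negOnePow_odd _ h, TensorProduct.tmul_neg]
        | add x z hx hz =>
          simp only [map_add, hx, hz, smul_add]
          abel
      | zero => simp
      | add x y _ _ hx hy =>
        simp only [map_add, LinearMap.add_apply, hx, hy, smul_add]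
        abel
      | smul s x _ hx =>
        simp only [map_smul, LinearMap.smul_apply, hx, smul_add, smul_comm s] }

end BaseChange

/-- A dg-module over a dg `R`-algebra `(B, d)` is locally degree-`0`-free of rank one if it is
finitely generated and `M_℘ ≅ (B_℘, d_℘)` (no shift) as dg-modules over `(B_℘, d_℘)` for every
prime `℘` of `R`, where `X_℘ = R_℘ ⊗ X`. -/
def IsLocallyFreeRankOne (M : DGMod D) : Prop :=
  Module.Finite B M.carrier ∧ ∀ p : PrimeSpectrum R,
    Isomorphic (M.baseChange (Localization.AtPrime p.asIdeal))
      (regular (D.baseChange (Localization.AtPrime p.asIdeal)))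

/-- The objects of `(B, d)-LF₀-dgmod`: finite direct sums of locally degree-`0`-free dg-modules
of rank one. -/
def IsLF0 (M : DGMod D) : Prop :=
  ∃ (n : ℕ) (L : Fin n → DGMod D), (∀ k, (L k).IsLocallyFreeRankOne) ∧ M.IsDirectSum L

lemma IsLocallyFreeRankOne.isLF0 {M : DGMod D} (hM : M.IsLocallyFreeRankOne) : M.IsLF0 := by
  refine ⟨1, fun _ => M, fun _ => hM, (LinearEquiv.funUnique (Fin 1) B M.carrier).symm, ?_, ?_⟩
  · intro i x
    exact ⟨fun h _ => h, fun h => h 0⟩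
  · intro x k
    rfl

variable (D) in
lemma isLocallyFreeRankOne_regular : (regular D).IsLocallyFreeRankOne := by
  refine ⟨(inferInstance : Module.Finite B B), fun p => ?_⟩
  have key : ∀ (x y : Localization.AtPrime p.asIdeal ⊗[R] B),
      (regular D).baseChangeAction (Localization.AtPrime p.asIdeal) x y = x * y := by
    intro x y
    induction x using TensorProduct.induction_on with
    | zero => exact (LinearMap.congr_fun (map_zero _) y).trans (zero_mul y).symm
    | tmul s b =>
      induction y using TensorProduct.induction_on with
      | zero => exact (map_zero _).trans (mul_zero (s ⊗ₜ[R] b : Localization.AtPrime p.asIdeal ⊗[R] B)).symm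
      | tmul t c =>
        rw [Algebra.TensorProduct.tmul_mul_tmul]
        exact baseChangeAction_tmul _ _ _ _ _ _
      | add x y hx hy =>
        exact (map_add _ _ _).trans ((congrArg₂ (· + ·) hx hy).trans
          (mul_add (s ⊗ₜ[R] b : Localization.AtPrime p.asIdeal ⊗[R] B) x y).symm)
    | add x z hx hz =>
      exact (LinearMap.congr_fun (map_add _ x z) y).trans
        ((congrArg₂ (· + ·) hx hz).trans (add_mul (x : Localization.AtPrime p.asIdeal ⊗[R] B) z y).symm)
  exact ⟨⟨{ toFun := fun x => x, map_add' := fun _ _ => rfl, map_smul' := key },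
      fun _ _ h => h, fun _ => rfl⟩,
    ⟨{ toFun := fun x => x, map_add' := fun _ _ => rfl, map_smul' := fun x y => (key x y).symm },
      fun _ _ h => h, fun _ => rfl⟩, fun _ => rfl, fun _ => rfl⟩

end DGMod

/-! ### The Grothendieck group `G₀((B, d)-LF₀-dgmod)` and the class group -/

section GrothendieckGroup

variable {R : Type u} {B : Type w} [CommRing R] [Ring B] [Algebra R B] (D : DGAlgebra R B)

/-- Isomorphism of objects of `(B, d)-LF₀-dgmod`. -/
def LF0Setoid : Setoid {M : DGMod D // M.IsLF0} where
  r X Y := DGMod.Isomorphic X.1 Y.1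
  iseqv := ⟨fun X => .refl X.1, fun h => h.symm, fun h h' => h.trans h'⟩

/-- Isomorphism classes of objects of `(B, d)-LF₀-dgmod`. -/
def LF0Class : Type (max u (w + 1)) := Quotient (LF0Setoid D)

/-- The relations `[X] - [Y] - [Z]`, one for each short exact sequence `0 → Y → X → Z → 0` of
dg-modules with `X`, `Y`, `Z` in `(B, d)-LF₀-dgmod`. -/
def G0Relations : AddSubgroup (FreeAbelianGroup (LF0Class D)) :=
  AddSubgroup.closure {x | ∃ X Y Z : {M : DGMod D // M.IsLF0},
    DGMod.HasShortExact Y.1 X.1 Z.1 ∧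
    x = FreeAbelianGroup.of (Quotient.mk (LF0Setoid D) X)
      - FreeAbelianGroup.of (Quotient.mk (LF0Setoid D) Y)
      - FreeAbelianGroup.of (Quotient.mk (LF0Setoid D) Z)}

/-- The Grothendieck group `G₀((B, d)-LF₀-dgmod)`. -/
abbrev G0 : Type (max u (w + 1)) := FreeAbelianGroup (LF0Class D) ⧸ G0Relations D

variable {D} in
/-- The class `[M]` in `G₀` of an object `M` of `(B, d)-LF₀-dgmod`. -/
def G0.cls (M : DGMod D) (hM : M.IsLF0) : G0 D :=
  QuotientAddGroup.mk (FreeAbelianGroup.of (Quotient.mk (LF0Setoid D) ⟨M, hM⟩))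

/-- The class `[(B, d)]` of the regular dg-module. -/
def G0.regularCls : G0 D :=
  G0.cls (DGMod.regular D) (DGMod.isLocallyFreeRankOne_regular D).isLF0

/-- The class group `Cl(B, d)`: the subgroup of `G₀` generated by the elements `[L] - [B]` for
locally degree-`0`-free dg-lattices `L` of rank one. -/
def DGClassGroup : AddSubgroup (G0 D) :=
  AddSubgroup.closure {x | ∃ (L : DGMod D) (hL : L.IsLocallyFreeRankOne),
    Module.Projective R L.carrier ∧ x = G0.cls L hL.isLF0 - G0.regularCls D}

end GrothendieckGroup

/-! ### Differential graded orders and their idèles -/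

section Orders

variable {R : Type u} {K : Type v} {A : Type w} [CommRing R] [Field K] [Algebra R K]
  [Ring A] [Algebra K A] [Algebra R A] [IsScalarTower R K A]

/-- `Λ` is a dg `R`-order in the dg `K`-algebra `(A, d)`: a subalgebra of `A`, finitely generated
and projective over `R`, spanning `A` over `K`, graded, and stable under `d`. -/
structure IsDGOrder (D : DGAlgebra K A) (Λ : Subalgebra R A) : Prop where
  finite : Module.Finite R Λ
  projective : Module.Projective R Λ
  span_eq_top : Submodule.span K (Λ : Set A) = ⊤
  homogeneous : DirectSum.SetLike.IsHomogeneous D.gr Λ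
  d_mem : ∀ a ∈ Λ, D.d a ∈ Λ

namespace IsDGOrder

variable {D : DGAlgebra K A} {Λ : Subalgebra R A} (hΛ : IsDGOrder D Λ)

/-- A dg-order as a dg `R`-algebra, with grading and differential restricted from `A`. -/
def toDGAlgebra : DGAlgebra R Λ where
  gr i := ((D.gr i).restrictScalars R).comap Λ.val.toLinearMap
  gradedAlgebra :=
    { toDecomposition := DirectSum.IsInternal.chooseDecomposition _
        (isInternal_of_homogeneous D.gr (Subalgebra.toSubmodule Λ) hΛ.homogeneous)
      one_mem := SetLike.GradedOne.one_mem (A := D.gr)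
      mul_mem := fun _ _ _ _ ha hb => SetLike.GradedMul.mul_mem (A := D.gr) ha hb }
  d := (D.d.restrictScalars R ∘ₗ Λ.val.toLinearMap).codRestrict (Subalgebra.toSubmodule Λ)
    (fun a => hΛ.d_mem a a.2)
  d_mem i a ha := D.d_mem i a ha
  d_d a := Subtype.ext (D.d_d a)
  leibniz i a b ha := by
    apply Subtype.ext
    refine (D.leibniz i a b ha).trans ?_
    rcases Int.even_or_odd i with h | h
    · simp only [Int.negOnePow_even _ h, one_smul]; rfl
    · simp only [Int.negOnePow_odd _ h, Units.neg_smul, one_smul]; rfl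

end IsDGOrder

variable [IsDedekindDomain R] [IsFractionRing R K]

section Completion

variable (Λ : Subalgebra R A) (𝔭 : HeightOneSpectrum R)

variable (K A) in
/-- The completion `K̂_℘ ⊗ A` of `A` at a nonzero prime `℘`. -/
abbrev completedAlgebra : Type (max v w) := (𝔭.adicCompletion K) ⊗[K] A

variable (K) in
/-- The completion `R̂_℘ · Λ` of `Λ` at a nonzero prime `℘`, inside `K̂_℘ ⊗ A`. -/
def completedOrder : Subalgebra (𝔭.adicCompletionIntegers K) (completedAlgebra K A 𝔭) :=
  (Submodule.span (𝔭.adicCompletionIntegers K)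
    ((fun a : A => (1 : 𝔭.adicCompletion K) ⊗ₜ[K] a) '' (Λ : Set A))).toSubalgebra
    (Submodule.subset_span ⟨1, Λ.one_mem, rfl⟩)
    (by
      intro x y hx hy
      induction hx using Submodule.span_induction with
      | mem x hx =>
        obtain ⟨a, ha, rfl⟩ := hx
        induction hy using Submodule.span_induction with
        | mem y hy =>
          obtain ⟨b, hb, rfl⟩ := hy
          exact Submodule.subset_span ⟨a * b, Λ.mul_mem ha hb, by simp⟩
        | zero => simp
        | add y z _ _ hy hz => rw [mul_add]; exact add_mem hy hz
        | smul s y _ hy => rw [mul_smul_comm]; exact Submodule.smul_mem _ _ hy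
      | zero => simp
      | add x z _ _ hx hz => rw [add_mul]; exact add_mem hx hz
      | smul s x _ hx => rw [smul_mul_assoc]; exact Submodule.smul_mem _ _ hx)

/-- The units `Λ̂_℘^×`, as a subgroup of `(K̂_℘ ⊗ A)^×`. -/
def completedOrderUnits : Subgroup (completedAlgebra K A 𝔭)ˣ :=
  (completedOrder K Λ 𝔭).toSubmonoid.units

end Completion

variable (D : DGAlgebra K A) (Λ : Subalgebra R A)

/-- The group `Ĵ(A, d)` of families `(u(℘))`, indexed by the nonzero primes of `R`, of homogeneous
units of `Â_℘` in `ker d` with `u(℘) ∈ Λ̂_℘^×` for almost all `℘`. -/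
def ideleGroup : Subgroup (∀ 𝔭 : HeightOneSpectrum R, (completedAlgebra K A 𝔭)ˣ) where
  carrier := {α | (∀ 𝔭, α 𝔭 ∈ (D.baseChange (𝔭.adicCompletion K)).cycleUnits) ∧
    ∀ᶠ 𝔭 in Filter.cofinite, α 𝔭 ∈ completedOrderUnits Λ 𝔭}
  one_mem' := ⟨fun _ => one_mem _, .of_forall fun _ => one_mem _⟩
  mul_mem' h h' := ⟨fun 𝔭 => mul_mem (h.1 𝔭) (h'.1 𝔭), by
    filter_upwards [h.2, h'.2] with 𝔭 h1 h2 using mul_mem h1 h2⟩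
  inv_mem' h := ⟨fun 𝔭 => inv_mem (h.1 𝔭), by
    filter_upwards [h.2] with 𝔭 h1 using inv_mem h1⟩

/-- The subgroup `Û(Λ, d)` of `Ĵ(A, d)`: all components lie in `Λ̂_℘^×`. -/
def unitIdeles : Subgroup (ideleGroup D Λ) where
  carrier := {α | ∀ 𝔭, α.1 𝔭 ∈ completedOrderUnits Λ 𝔭}
  one_mem' _ := one_mem _
  mul_mem' h h' 𝔭 := mul_mem (h 𝔭) (h' 𝔭)
  inv_mem' h 𝔭 := inv_mem (h 𝔭)

/-- The subgroup of `Ĵ(A, d)` of diagonally embedded elements of `A^× ∩ ker d`. -/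
def principalIdeles : Subgroup (ideleGroup D Λ) where
  carrier := {α | ∃ x ∈ D.cycleUnits, ∀ 𝔭,
    α.1 𝔭 = Units.map (Algebra.TensorProduct.includeRight :
      A →ₐ[K] completedAlgebra K A 𝔭).toMonoidHom x}
  one_mem' := ⟨1, one_mem _, fun 𝔭 => (map_one _).symm⟩
  mul_mem' := by
    rintro _ _ ⟨x, hx, h⟩ ⟨y, hy, h'⟩
    exact ⟨x * y, mul_mem hx hy, fun 𝔭 => by
      rw [map_mul, ← h 𝔭, ← h' 𝔭]; rfl⟩
  inv_mem' := by
    rintro _ ⟨x, hx, h⟩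
    exact ⟨x⁻¹, inv_mem hx, fun 𝔭 => by
      rw [map_inv, ← h 𝔭]; rfl⟩

/-- The double cosets `Û(Λ, d) \ Ĵ(A, d) / (A^× ∩ ker d)`. -/
abbrev IdeleDoubleCosets : Type (max u v w) :=
  DoubleCoset.Quotient (unitIdeles D Λ : Set (ideleGroup D Λ)) (principalIdeles D Λ)

variable {D Λ}

lemma completedOrder_homogeneous (hΛ : IsDGOrder D Λ) (𝔭 : HeightOneSpectrum R) (i : ℤ)
    (x : completedAlgebra K A 𝔭) (hx : x ∈ completedOrder K Λ 𝔭) :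
    (DirectSum.decompose (D.baseChange (𝔭.adicCompletion K)).gr x i : completedAlgebra K A 𝔭)
      ∈ completedOrder K Λ 𝔭 := by
  have hx' : x ∈ Submodule.span (𝔭.adicCompletionIntegers K)
    ((fun a : A => (1 : 𝔭.adicCompletion K) ⊗ₜ[K] a) '' (Λ : Set A)) := hx
  clear hx
  induction hx' using Submodule.span_induction with
  | mem x hx =>
    obtain ⟨a, ha, rfl⟩ := hx
    rw [DGAlgebra.decompose_baseChange_tmul]
    exact Submodule.subset_span ⟨_, hΛ.homogeneous i ha, rfl⟩
  | zero => simp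
  | add x y _ _ hx hy =>
    rw [DirectSum.decompose_add, DirectSum.add_apply, Submodule.coe_add]
    exact add_mem hx hy
  | smul s x _ hx =>
    change (DirectSum.decompose (D.baseChange (𝔭.adicCompletion K)).gr
      ((s : 𝔭.adicCompletion K) • x) i : completedAlgebra K A 𝔭) ∈ _
    rw [DirectSum.decompose_smul, DirectSum.smul_apply, Submodule.coe_smul]
    exact Subalgebra.smul_mem _ hx s

lemma completedOrder_d_mem (hΛ : IsDGOrder D Λ) (𝔭 : HeightOneSpectrum R)
    (x : completedAlgebra K A 𝔭) (hx : x ∈ completedOrder K Λ 𝔭) :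
    (D.baseChange (𝔭.adicCompletion K)).d x ∈ completedOrder K Λ 𝔭 := by
  have hx' : x ∈ Submodule.span (𝔭.adicCompletionIntegers K)
    ((fun a : A => (1 : 𝔭.adicCompletion K) ⊗ₜ[K] a) '' (Λ : Set A)) := hx
  clear hx
  induction hx' using Submodule.span_induction with
  | mem x hx =>
    obtain ⟨a, ha, rfl⟩ := hx
    exact Submodule.subset_span ⟨_, hΛ.d_mem a ha, rfl⟩
  | zero => simp
  | add x y _ _ hx hy => rw [map_add]; exact add_mem hx hy
  | smul s x _ hx =>
    change (D.baseChange (𝔭.adicCompletion K)).d ((s : 𝔭.adicCompletion K) • x) ∈ _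
    rw [map_smul]
    exact Subalgebra.smul_mem _ hx s

/-- `Λα = A ∩ ⋂_℘ Λ̂_℘ α(℘)`, as a `Λ`-submodule of `A`. -/
def ideleSubmodule (α : ideleGroup D Λ) : Submodule Λ A where
  carrier := {a | ∀ 𝔭 : HeightOneSpectrum R, ∃ x ∈ completedOrder K Λ 𝔭,
    (1 : 𝔭.adicCompletion K) ⊗ₜ[K] a = x * (α.1 𝔭 : completedAlgebra K A 𝔭)}
  zero_mem' 𝔭 := ⟨0, zero_mem _, by simp⟩
  add_mem' := by
    intro a b ha hb 𝔭
    obtain ⟨x, hx, h⟩ := ha 𝔭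
    obtain ⟨y, hy, h'⟩ := hb 𝔭
    exact ⟨x + y, add_mem hx hy, by rw [TensorProduct.tmul_add, h, h', add_mul]⟩
  smul_mem' := by
    intro l a ha 𝔭
    obtain ⟨x, hx, h⟩ := ha 𝔭
    refine ⟨(1 ⊗ₜ[K] (l : A)) * x, mul_mem (Submodule.subset_span ⟨l, l.2, rfl⟩) hx, ?_⟩
    rw [mul_assoc, ← h, Algebra.TensorProduct.tmul_mul_tmul, one_mul]
    rfl

lemma ideleSubmodule_homogeneous (hΛ : IsDGOrder D Λ) (α : ideleGroup D Λ) :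
    DirectSum.SetLike.IsHomogeneous D.gr ((ideleSubmodule α).restrictScalars R) := by
  intro i a ha 𝔭
  obtain ⟨x, hx, h⟩ := ha 𝔭
  obtain ⟨⟨k, hk⟩, -⟩ := α.2.1 𝔭
  refine ⟨_, completedOrder_homogeneous hΛ 𝔭 (i - k) x hx, ?_⟩
  rw [← DGAlgebra.decompose_baseChange_tmul, h,
    ← DirectSum.coe_decompose_mul_add_of_right_mem _ hk, sub_add_cancel]

lemma ideleSubmodule_d_mem (hΛ : IsDGOrder D Λ) (α : ideleGroup D Λ) (a : A)
    (ha : a ∈ ideleSubmodule α) : D.d a ∈ ideleSubmodule α := by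
  intro 𝔭
  obtain ⟨x, hx, h⟩ := ha 𝔭
  refine ⟨_, completedOrder_d_mem hΛ 𝔭 x hx, ?_⟩
  rw [← DGAlgebra.d_mul_of_cycle _ _ _ (α.2.1 𝔭).2, ← h]
  rfl

/-- The homogeneous components `A_i ∩ Λα` of `Λα`. -/
def ideleGrading (α : ideleGroup D Λ) (i : ℤ) : Submodule R (ideleSubmodule α) :=
  ((D.gr i).restrictScalars R).comap ((ideleSubmodule α).restrictScalars R).subtype

lemma ideleGrading_isInternal (hΛ : IsDGOrder D Λ) (α : ideleGroup D Λ) :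
    DirectSum.IsInternal (ideleGrading α) :=
  isInternal_of_homogeneous D.gr ((ideleSubmodule α).restrictScalars R)
    (ideleSubmodule_homogeneous hΛ α)

/-- The dg-module `Λα`, with grading and differential restricted from `A`. -/
def ideleModule (hΛ : IsDGOrder D Λ) (α : ideleGroup D Λ) : DGMod hΛ.toDGAlgebra where
  carrier := ideleSubmodule α
  isScalarTower := ⟨fun r l n => Subtype.ext (smul_assoc r l (n : A))⟩
  gr := ideleGrading α
  decomposition := DirectSum.IsInternal.chooseDecomposition _ (ideleGrading_isInternal hΛ α)
  smul_mem _ _ _ _ ha hm := SetLike.GradedMul.mul_mem (A := D.gr) ha hm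
  d := (D.d.restrictScalars R ∘ₗ ((ideleSubmodule α).restrictScalars R).subtype).codRestrict
    ((ideleSubmodule α).restrictScalars R) (fun a => ideleSubmodule_d_mem hΛ α a a.2)
  d_mem i a ha := D.d_mem i a ha
  d_d a := Subtype.ext (D.d_d a)
  leibniz i a b ha := by
    apply Subtype.ext
    refine (D.leibniz i a b ha).trans ?_
    rcases Int.even_or_odd i with h | h
    · simp only [Int.negOnePow_even _ h, one_smul]; rfl
    · simp only [Int.negOnePow_odd _ h, Units.neg_smul, one_smul]; rfl

end Orders

end

/-! Since `A` is finite-dimensional over `K`, only finitely many degrees of `A` and of its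
completions are nonzero, while the powers of a unit never vanish; hence homogeneous units have
degree 0 (`mem_gr_zero_of_isUnit`). The components of an idèle are therefore degree-0 cycles, and by
flatness the degree-0 cycles of `Â_℘` are spanned by those of `A`. Strong approximation in `K`,
applied to coordinates, yields a global degree-0 cycle close to given idèle components at finitely
many primes and integral at the others. By Nakayama, closeness to a unit means agreement up to a
unit of `Λ̂_℘` (`exists_cycleUnit_approx`).

Local freeness: approximating `α` at one prime gives `y ∈ Λα` with `(Λα)_℘ = Λ_℘ y`
(`exists_local_generator`), and right multiplication by a degree-0 cycle is a homomorphism of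
dg-modules.

Additivity: multiplying `α` or `β` on the right by a global unit `x` does not change the isomorphism
class of its module. A central scalar from `R` makes `α` integral, and an `x` approximating `β⁻¹`
makes `βx` integral, and a local unit wherever `α` or `β` is not one. Then `Λα + Λβx = Λ` and `Λα ∩
Λβx = Λαβx`, so there is an exact sequence `0 → Λαβx → Λα ⊕ Λβx → Λ → 0`
(`hasShortExact_ideleModule`), which is the required relation in `G₀`.

Surjectivity: clearing denominators in a generic isomorphism embeds a lattice `L` into `Λ`. At each
prime the image is generated by a global unit `y`, and only the finitely many primes dividing the
denominator matter, so these `y` form an idèle (`exists_isomorphic_ideleModule`). Finally, both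
kinds of factors in a double coset lie in the kernel. -/

/-! ### Homogeneous components under base change -/

lemma decompose_baseChange_tmul {R M : Type*} [CommRing R] [AddCommGroup M] [Module R M]
    (S : Type*) [CommRing S] [Algebra R S] (gr : ℤ → Submodule R M)
    [DirectSum.Decomposition gr] (m : M) (i : ℤ) :
    (DirectSum.decompose (fun i => (gr i).baseChange S) ((1 : S) ⊗ₜ[R] m) i : S ⊗[R] M) =
      (1 : S) ⊗ₜ[R] (DirectSum.decompose gr m i : M) := by
  induction m using DirectSum.Decomposition.inductionOn gr with
  | zero => simp
  | @homogeneous j m =>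
    have hm : (1 : S) ⊗ₜ[R] (m : M) ∈ (gr j).baseChange S :=
      Submodule.tmul_mem_baseChange_of_mem _ m.2
    by_cases h : j = i
    · subst h
      rw [DirectSum.decompose_of_mem_same (fun i => (gr i).baseChange S) hm,
        DirectSum.decompose_of_mem_same _ m.2]
    · rw [DirectSum.decompose_of_mem_ne (fun i => (gr i).baseChange S) hm h,
        DirectSum.decompose_of_mem_ne _ m.2 h, TensorProduct.tmul_zero]
  | add m m' h h' =>
    simp only [TensorProduct.tmul_add, DirectSum.decompose_add, DirectSum.add_apply,
      Submodule.coe_add, h, h']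

/-- The `i`-th component of `1 ⊗ m` is `1 ⊗ mᵢ`, so injectivity forces `m = mᵢ`. This lets the
degree of a map be checked after localisation. -/
lemma mem_of_tmul_mem_baseChange {R M : Type*} [CommRing R] [AddCommGroup M] [Module R M]
    (S : Type*) [CommRing S] [Algebra R S] (gr : ℤ → Submodule R M)
    [DirectSum.Decomposition gr] (hinj : Function.Injective (TensorProduct.mk R S M 1))
    {m : M} {i : ℤ} (h : (1 : S) ⊗ₜ[R] m ∈ (gr i).baseChange S) : m ∈ gr i := by
  have h1 := decompose_baseChange_tmul S gr m i
  rw [DirectSum.decompose_of_mem_same (fun i => (gr i).baseChange S) h] at h1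
  rw [hinj h1]
  exact SetLike.coe_mem _

/-! ### Homomorphisms of dg-modules, base change and localisation -/

namespace DGMod

section Generalities

variable {R : Type u} {B : Type w} [CommRing R] [Ring B] [Algebra R B] {D : DGAlgebra R B}

lemma Hom.decompose_apply {M N : DGMod D} (f : Hom M N) (m : M.carrier) (i : ℤ) :
    (DirectSum.decompose N.gr (f.toLinearMap m) i : N.carrier) =
      f.toLinearMap (DirectSum.decompose M.gr m i : M.carrier) := by
  induction m using DirectSum.Decomposition.inductionOn M.gr with
  | zero => simp
  | @homogeneous j m =>
    have hm := f.map_gr j m m.2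
    by_cases h : j = i
    · subst h
      rw [DirectSum.decompose_of_mem_same _ hm, DirectSum.decompose_of_mem_same _ m.2]
    · rw [DirectSum.decompose_of_mem_ne _ hm h, DirectSum.decompose_of_mem_ne _ m.2 h, map_zero]
  | add m m' h h' =>
    simp only [map_add, DirectSum.decompose_add, DirectSum.add_apply, Submodule.coe_add, h, h']

/-- An injective homomorphism of dg-modules reflects homogeneous components. -/
lemma Hom.mem_gr_of_injective {M N : DGMod D} (f : Hom M N)
    (hf : Function.Injective f.toLinearMap) {i : ℤ} {m : M.carrier}
    (h : f.toLinearMap m ∈ N.gr i) : m ∈ M.gr i := by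
  have h1 := f.decompose_apply m i
  rw [DirectSum.decompose_of_mem_same _ h] at h1
  rw [hf h1]
  exact SetLike.coe_mem _

/-- The linear inverse respects degrees and differentials automatically, because an injective
homomorphism reflects both. -/
lemma Isomorphic.of_bijective {M N : DGMod D} (f : Hom M N)
    (hf : Function.Bijective f.toLinearMap) : Isomorphic M N := by
  let e := LinearEquiv.ofBijective f.toLinearMap hf
  have he : ∀ n, f.toLinearMap (e.symm n) = n := e.apply_symm_apply
  refine ⟨f, ⟨e.symm.toLinearMap, fun i n hn => ?_, fun n => ?_⟩, e.symm_apply_apply, he⟩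
  · refine f.mem_gr_of_injective hf.1 ?_
    rw [LinearEquiv.coe_coe, he]
    exact hn
  · apply hf.1
    simp only [LinearEquiv.coe_coe]
    rw [f.map_d, he, he]

section BaseChange

variable (S : Type v) [CommRing S] [Algebra R S]

/-- The homomorphism `id ⊗ f`. -/
def Hom.baseChange {M N : DGMod D} (f : Hom M N) : Hom (M.baseChange S) (N.baseChange S) where
  toLinearMap :=
    { toFun := (f.toLinearMap.restrictScalars R).baseChange S
      map_add' := map_add ((f.toLinearMap.restrictScalars R).baseChange S)
      map_smul' := by
        have key : ∀ (x : S ⊗[R] B) (y : S ⊗[R] M.carrier),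
            (f.toLinearMap.restrictScalars R).baseChange S (M.baseChangeAction S x y) =
              N.baseChangeAction S x ((f.toLinearMap.restrictScalars R).baseChange S y) := by
          intro x y
          induction x using TensorProduct.induction_on with
          | zero => simp
          | tmul s b =>
            induction y using TensorProduct.induction_on with
            | zero => simp
            | tmul t m => simp [baseChangeAction_tmul]
            | add y z hy hz => simp only [map_add, hy, hz]
          | add x z hx hz => simp only [map_add, LinearMap.add_apply, hx, hz]
        exact key }
  map_gr := by
    have key : ∀ (i : ℤ) (m : S ⊗[R] M.carrier), m ∈ (M.gr i).baseChange S →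
        (f.toLinearMap.restrictScalars R).baseChange S m ∈ (N.gr i).baseChange S := by
      intro i m hm
      rw [Submodule.baseChange_eq_span] at hm
      induction hm using Submodule.span_induction with
      | mem x hx =>
        obtain ⟨y, hy, rfl⟩ := hx
        exact Submodule.tmul_mem_baseChange_of_mem _ (f.map_gr i y hy)
      | zero => rw [map_zero]; exact zero_mem _
      | add x y _ _ hx hy => rw [map_add]; exact add_mem hx hy
      | smul s x _ hx => rw [map_smul]; exact Submodule.smul_mem _ _ hx
    exact key
  map_d := by
    have key : ∀ m : S ⊗[R] M.carrier,
        (f.toLinearMap.restrictScalars R).baseChange S (M.d.baseChange S m) =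
          N.d.baseChange S ((f.toLinearMap.restrictScalars R).baseChange S m) := by
      intro m
      induction m using TensorProduct.induction_on with
      | zero => simp
      | tmul s x => simp [f.map_d]
      | add x y hx hy => simp only [map_add, hx, hy]
    exact key

/-- Homomorphisms which are mutually inverse up to a scalar induce isomorphisms over every ring
in which this scalar is invertible. -/
lemma isomorphic_baseChange_of_comp_eq_smul {M N : DGMod D} (f : Hom M N)
    (g : N.carrier →ₗ[R] M.carrier) (s : R) (hs : IsUnit (algebraMap R S s))
    (hgf : ∀ m, g (f.toLinearMap m) = s • m) (hfg : ∀ n, f.toLinearMap (g n) = s • n) :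
    Isomorphic (M.baseChange S) (N.baseChange S) := by
  have h1 : g.baseChange S ∘ₗ (f.toLinearMap.restrictScalars R).baseChange S =
      algebraMap R S s • LinearMap.id := by
    ext m
    simp [hgf]
  have h2 : (f.toLinearMap.restrictScalars R).baseChange S ∘ₗ g.baseChange S =
      algebraMap R S s • LinearMap.id := by
    ext m
    simp [hfg]
  obtain ⟨t, ht⟩ := hs
  have key : Function.Bijective ((f.toLinearMap.restrictScalars R).baseChange S) := by
    have h3 : ∀ z, g.baseChange S ((f.toLinearMap.restrictScalars R).baseChange S z) = t • z :=
      fun z => (LinearMap.congr_fun h1 z).trans (by rw [← ht]; rfl)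
    have h4 : ∀ z, (f.toLinearMap.restrictScalars R).baseChange S (g.baseChange S z) = t • z :=
      fun z => (LinearMap.congr_fun h2 z).trans (by rw [← ht]; rfl)
    refine ⟨fun x y hxy => ?_, fun y => ⟨t⁻¹ • g.baseChange S y, ?_⟩⟩
    · have h5 := congrArg (g.baseChange S) hxy
      rw [h3, h3] at h5
      exact smul_left_cancel t h5
    · rw [Units.smul_def, map_smul, h4, ← Units.smul_def, inv_smul_smul]
  exact Isomorphic.of_bijective (f.baseChange S) key

/-- The map on tensor products underlying a homomorphism between base changes. -/
def Hom.onTensor {M N : DGMod D} (φ : Hom (M.baseChange S) (N.baseChange S)) :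
    S ⊗[R] M.carrier →ₗ[S] S ⊗[R] N.carrier :=
  φ.toLinearMap.restrictScalars S

end BaseChange

section Localization

variable (p : Ideal R) [p.IsPrime]

/-- Homomorphisms between localisations come, up to a scalar, from homomorphisms. -/
lemma Hom.exists_of_localization {M N : DGMod D} [Module.Finite B M.carrier]
    (hN : Function.Injective (TensorProduct.mk R (Localization.AtPrime p) N.carrier 1))
    (φ : Hom (M.baseChange (Localization.AtPrime p)) (N.baseChange (Localization.AtPrime p))) :
    ∃ (f : Hom M N) (t : R), t ∉ p ∧ ∀ m : M.carrier,
      (1 : Localization.AtPrime p) ⊗ₜ[R] f.toLinearMap m = t • φ.onTensor _ (1 ⊗ₜ[R] m) := by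
  classical
  let S := Localization.AtPrime p
  let φ' : S ⊗[R] M.carrier →ₗ[S] S ⊗[R] N.carrier := φ.onTensor _
  have φ_smul : ∀ (x : S ⊗[R] B) y, φ' (M.baseChangeAction S x y) =
      N.baseChangeAction S x (φ' y) := φ.toLinearMap.map_smul
  have φ_d : ∀ x, φ' (M.d.baseChange S x) = N.d.baseChange S (φ' x) := φ.map_d
  have φ_gr : ∀ i x, x ∈ (M.gr i).baseChange S → φ' x ∈ (N.gr i).baseChange S := φ.map_gr
  have act : ∀ (P : DGMod D) (b : B) (x : S ⊗[R] P.carrier) (t : R),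
      P.baseChangeAction S (1 ⊗ₜ b) (t • x) = t • P.baseChangeAction S (1 ⊗ₜ b) x :=
    fun P b x t => LinearMap.map_smul_of_tower _ t x
  have φ_smul' : ∀ (b : B) (m : M.carrier), φ' (1 ⊗ₜ (b • m)) =
      N.baseChangeAction S (1 ⊗ₜ b) (φ' (1 ⊗ₜ m)) := by
    intro b m
    rw [← φ_smul, baseChangeAction_tmul, one_mul]
  obtain ⟨T, hT⟩ := (inferInstance : Module.Finite B M.carrier).fg_top
  have hsurj : ∀ y : S ⊗[R] N.carrier, ∃ t : R, t ∉ p ∧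
      ∃ n : N.carrier, (1 : S) ⊗ₜ[R] n = t • y := by
    intro y
    obtain ⟨⟨n, t⟩, h⟩ := IsLocalizedModule.surj p.primeCompl
      (TensorProduct.mk R S N.carrier 1) y
    exact ⟨t, t.2, n, h.symm⟩
  choose t ht n hn using hsurj
  -- A common denominator for the images of finitely many `B`-generators serves for all of `M`,
  -- since `φ'` is `B`-linear.
  let τ : R := ∏ m ∈ T, t (φ' (1 ⊗ₜ m))
  have hτ : τ ∉ p := (Ideal.IsPrime.prod_mem_iff (p := p)).not.2 (by push Not; exact fun m _ => ht _)
  have hex : ∀ m : M.carrier, ∃ n : N.carrier, (1 : S) ⊗ₜ[R] n = τ • φ' (1 ⊗ₜ m) := by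
    intro m
    have hm : m ∈ Submodule.span B (T : Set M.carrier) := hT ▸ Submodule.mem_top
    induction hm using Submodule.span_induction with
    | mem m hm =>
      refine ⟨(∏ m' ∈ T.erase m, t (φ' (1 ⊗ₜ m'))) • n (φ' (1 ⊗ₜ m)), ?_⟩
      rw [TensorProduct.tmul_smul, hn, smul_smul, Finset.prod_erase_mul _ _ hm]
    | zero =>
      refine ⟨0, ?_⟩
      rw [TensorProduct.tmul_zero, TensorProduct.tmul_zero, map_zero, smul_zero]
    | add x y _ _ hx hy =>
      obtain ⟨n, hn⟩ := hx
      obtain ⟨n', hn'⟩ := hy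
      exact ⟨n + n', by rw [TensorProduct.tmul_add, TensorProduct.tmul_add, map_add, smul_add, hn, hn']⟩
    | smul b x _ hx =>
      obtain ⟨n, hn⟩ := hx
      refine ⟨b • n, ?_⟩
      rw [φ_smul', ← act, ← hn, baseChangeAction_tmul, one_mul]
  choose f hf using hex
  refine ⟨⟨⟨⟨f, fun x y => hN ?_⟩, fun b x => hN ?_⟩, fun i m hm => ?_, fun m => hN ?_⟩, τ, hτ, hf⟩
  · simp only [TensorProduct.mk_apply]
    rw [hf, TensorProduct.tmul_add, TensorProduct.tmul_add, map_add, smul_add, hf, hf]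
  · simp only [TensorProduct.mk_apply, RingHom.id_apply]
    rw [hf, φ_smul', ← act, ← hf, baseChangeAction_tmul, one_mul]
  · refine mem_of_tmul_mem_baseChange S N.gr hN ?_
    change (1 : S) ⊗ₜ[R] f m ∈ _
    rw [hf, ← algebraMap_smul S τ (φ' (1 ⊗ₜ m))]
    exact Submodule.smul_mem _ _ (φ_gr i _ (Submodule.tmul_mem_baseChange_of_mem _ hm))
  · change (1 : S) ⊗ₜ[R] f (M.d m) = (1 : S) ⊗ₜ[R] N.d (f m)
    have h1 : ∀ n, (1 : S) ⊗ₜ[R] N.d n = N.d.baseChange S (1 ⊗ₜ n) := fun n => by simp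
    rw [hf, h1, hf, LinearMap.map_smul_of_tower, ← φ_d, LinearMap.baseChange_tmul]

/-- Isomorphisms between localisations come, up to scalars, from homomorphisms. -/
lemma exists_comp_eq_smul_of_isomorphic {M N : DGMod D} [Module.Finite B M.carrier]
    [Module.Finite B N.carrier]
    (hM : Function.Injective (TensorProduct.mk R (Localization.AtPrime p) M.carrier 1))
    (hN : Function.Injective (TensorProduct.mk R (Localization.AtPrime p) N.carrier 1))
    (h : Isomorphic (M.baseChange (Localization.AtPrime p))
      (N.baseChange (Localization.AtPrime p))) :
    ∃ (f : Hom M N) (g : Hom N M) (s : R), s ∉ p ∧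
      (∀ m, g.toLinearMap (f.toLinearMap m) = s • m) ∧
      ∀ n, f.toLinearMap (g.toLinearMap n) = s • n := by
  obtain ⟨φ, ψ, h1, h2⟩ := h
  obtain ⟨f, t, ht, hf⟩ := Hom.exists_of_localization p hN φ
  obtain ⟨g, t', ht', hg⟩ := Hom.exists_of_localization p hM ψ
  refine ⟨f, g, t * t', fun h => (Ideal.IsPrime.mem_or_mem ‹_› h).elim ht ht',
    fun m => hM ?_, fun n => hN ?_⟩
  · simp only [TensorProduct.mk_apply]
    rw [hg, hf, LinearMap.map_smul_of_tower, TensorProduct.tmul_smul, smul_smul, mul_comm t t']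
    exact congrArg _ (h1 _)
  · simp only [TensorProduct.mk_apply]
    rw [hf, hg, LinearMap.map_smul_of_tower, TensorProduct.tmul_smul, smul_smul]
    exact congrArg _ (h2 _)

end Localization
end Generalities
end DGMod

/-! ### Direct sums of two dg-modules -/

namespace DGMod

variable {R : Type u} {B : Type w} [CommRing R] [Ring B] [Algebra R B] {D : DGAlgebra R B}

lemma prod_isInternal (M N : DGMod D) :
    DirectSum.IsInternal fun i => (M.gr i).prod (N.gr i) := by
  classical
  -- The components of `y` can be recovered from its sum by decomposing the two coordinates; this
  -- gives injectivity.
  have key : ∀ (y : ⨁ i, (M.gr i).prod (N.gr i)) (i : ℤ),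
      (y i : M.carrier × N.carrier) =
        ((DirectSum.decompose M.gr (DirectSum.coeAddMonoidHom
            (fun i => (M.gr i).prod (N.gr i)) y).1 i : M.carrier),
          (DirectSum.decompose N.gr (DirectSum.coeAddMonoidHom
            (fun i => (M.gr i).prod (N.gr i)) y).2 i : N.carrier)) := by
    intro y
    induction y using DirectSum.induction_on with
    | zero => intro i; simp; rfl
    | of j x =>
      intro i
      obtain ⟨⟨m, n⟩, hm, hn⟩ := x
      rw [DirectSum.coeAddMonoidHom_of]
      by_cases h : j = i
      · subst h
        simp only [DirectSum.of_eq_same]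
        rw [DirectSum.decompose_of_mem_same _ hm, DirectSum.decompose_of_mem_same _ hn]
      · rw [DirectSum.of_eq_of_ne _ _ _ (Ne.symm h)]
        simp only
        rw [DirectSum.decompose_of_mem_ne _ hm h, DirectSum.decompose_of_mem_ne _ hn h]
        rfl
    | add x y hx hy => intro i; simp [hx i, hy i]
  refine ⟨fun x y hxy => DFinsupp.ext fun i => Subtype.ext ?_, fun x => ?_⟩
  · rw [key x i, key y i, hxy]
  · refine ⟨∑ i ∈ (DirectSum.decompose M.gr x.1).support,
      DirectSum.of (fun i => (M.gr i).prod (N.gr i)) i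
        ⟨(DirectSum.decompose M.gr x.1 i, 0), SetLike.coe_mem _, zero_mem _⟩ +
      ∑ i ∈ (DirectSum.decompose N.gr x.2).support,
      DirectSum.of (fun i => (M.gr i).prod (N.gr i)) i
        ⟨(0, DirectSum.decompose N.gr x.2 i), zero_mem _, SetLike.coe_mem _⟩, ?_⟩
    rw [map_add, map_sum, map_sum]
    simp only [DirectSum.coeAddMonoidHom_of]
    ext
    · simp [Prod.fst_sum, DirectSum.sum_support_decompose]
    · simp [Prod.snd_sum, DirectSum.sum_support_decompose]

/-- The direct sum of two dg-modules. -/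
noncomputable def prod (M N : DGMod D) : DGMod D where
  carrier := M.carrier × N.carrier
  gr i := (M.gr i).prod (N.gr i)
  decomposition := DirectSum.IsInternal.chooseDecomposition _ (prod_isInternal M N)
  smul_mem i j a m ha hm := ⟨M.smul_mem i j a m.1 ha hm.1, N.smul_mem i j a m.2 ha hm.2⟩
  d := M.d.prodMap N.d
  d_mem i m hm := ⟨M.d_mem i m.1 hm.1, N.d_mem i m.2 hm.2⟩
  d_d m := Prod.ext (M.d_d m.1) (N.d_d m.2)
  leibniz i a m ha := Prod.ext (M.leibniz i a m.1 ha) (N.leibniz i a m.2 ha)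

/-- The family consisting of two dg-modules. -/
def pair (M N : DGMod D) : Fin 2 → DGMod D
  | 0 => M
  | 1 => N

lemma prod_isDirectSum (M N : DGMod D) : (prod M N).IsDirectSum (pair M N) := by
  refine ⟨{ toFun := fun x k => match k with | 0 => x.1 | 1 => x.2
            map_add' := fun x y => funext fun k => by fin_cases k <;> rfl
            map_smul' := fun b x => funext fun k => by fin_cases k <;> rfl
            invFun := fun y => (y 0, y 1)
            left_inv := fun x => rfl
            right_inv := fun y => funext fun k => by fin_cases k <;> rfl }, ?_, ?_⟩
  · intro i x
    refine ⟨fun h k => ?_, fun h => ⟨h 0, h 1⟩⟩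
    fin_cases k
    exacts [h.1, h.2]
  · intro x k
    fin_cases k <;> rfl

lemma IsLocallyFreeRankOne.prod_isLF0 {M N : DGMod D} (hM : M.IsLocallyFreeRankOne)
    (hN : N.IsLocallyFreeRankOne) : (prod M N).IsLF0 :=
  ⟨2, pair M N, fun k => by fin_cases k <;> assumption, prod_isDirectSum M N⟩

lemma hasShortExact_prod (M N : DGMod D) : HasShortExact M (prod M N) N := by
  refine ⟨⟨LinearMap.inl B _ _, fun i m hm => ⟨hm, zero_mem _⟩,
      fun m => Prod.ext rfl (map_zero N.d).symm⟩,
    ⟨LinearMap.snd B _ _, fun i m hm => hm.2, fun m => rfl⟩,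
    LinearMap.inl_injective, Function.Exact.inl_snd, LinearMap.snd_surjective⟩

/-- The homomorphism into a direct sum with given components. -/
def Hom.prod {M N P : DGMod D} (f : Hom M N) (g : Hom M P) : Hom M (DGMod.prod N P) where
  toLinearMap := f.toLinearMap.prod g.toLinearMap
  map_gr i m hm := ⟨f.map_gr i m hm, g.map_gr i m hm⟩
  map_d m := Prod.ext (f.map_d m) (g.map_d m)

/-- The homomorphism from a direct sum with given components. -/
def Hom.coprod {M N P : DGMod D} (f : Hom M P) (g : Hom N P) : Hom (DGMod.prod M N) P where
  toLinearMap := f.toLinearMap.coprod g.toLinearMap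
  map_gr i m hm := add_mem (f.map_gr i m.1 hm.1) (g.map_gr i m.2 hm.2)
  map_d m := by
    change f.toLinearMap (M.d m.1) + g.toLinearMap (N.d m.2) =
      P.d (f.toLinearMap m.1 + g.toLinearMap m.2)
    rw [map_add, f.map_d, g.map_d]

end DGMod

/-! ### Relations in the Grothendieck group -/

namespace G0

variable {R : Type u} {B : Type w} [CommRing R] [Ring B] [Algebra R B] {D : DGAlgebra R B}

lemma cls_eq_of_isomorphic {M N : DGMod D} (hM : M.IsLF0) (hN : N.IsLF0)
    (h : DGMod.Isomorphic M N) : cls M hM = cls N hN := by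
  unfold cls
  congr 2
  exact Quotient.sound h

lemma cls_eq_add {X Y Z : DGMod D} (hX : X.IsLF0) (hY : Y.IsLF0) (hZ : Z.IsLF0)
    (h : DGMod.HasShortExact Y X Z) : cls X hX = cls Y hY + cls Z hZ := by
  rw [← sub_eq_zero, ← sub_sub]
  exact (QuotientAddGroup.eq_zero_iff _).2
    (AddSubgroup.subset_closure ⟨⟨X, hX⟩, ⟨Y, hY⟩, ⟨Z, hZ⟩, h, rfl⟩)

/-- Two extensions with the same middle term: `[M] + [N] = [Y] + [Z]` if there is a short exact
sequence `0 → Y → M ⊕ N → Z → 0`. -/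
lemma cls_add_cls_eq_of_hasShortExact_prod {M N Y Z : DGMod D} (hM : M.IsLocallyFreeRankOne)
    (hN : N.IsLocallyFreeRankOne) (hY : Y.IsLF0) (hZ : Z.IsLF0)
    (h : DGMod.HasShortExact Y (DGMod.prod M N) Z) :
    cls M hM.isLF0 + cls N hN.isLF0 = cls Y hY + cls Z hZ := by
  rw [← cls_eq_add (hM.prod_isLF0 hN) _ _ h,
    ← cls_eq_add (hM.prod_isLF0 hN) _ _ (DGMod.hasShortExact_prod M N)]

end G0

/-! ### Strong approximation in the field of fractions -/

namespace IsDedekindDomain.HeightOneSpectrum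

variable {R : Type*} {K : Type*} [CommRing R] [IsDedekindDomain R] [Field K] [Algebra R K]
  [IsFractionRing R K]

lemma valued_algebraMap (𝔭 : HeightOneSpectrum R) (k : K) :
    Valued.v (algebraMap K (𝔭.adicCompletion K) k) = 𝔭.valuation K k :=
  valuedAdicCompletion_eq_valuation' 𝔭 k

/-- The field is dense in its completions. -/
lemma exists_valued_sub_le (𝔭 : HeightOneSpectrum R) (c : 𝔭.adicCompletion K) {r : K}
    (hr : r ≠ 0) : ∃ k : K, Valued.v (algebraMap K (𝔭.adicCompletion K) k - c) ≤
      𝔭.valuation K r := by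
  let ρ := algebraMap K (𝔭.adicCompletion K) r
  have hρ : ρ ≠ 0 := by simpa [ρ] using hr
  -- After rescaling by `ρ`, the desired ball around `c` is the preimage of the valuation ring,
  -- which is open.
  have hcont : Continuous (fun x : 𝔭.adicCompletion K => (x - c) * ρ⁻¹) :=
    (continuous_id.sub continuous_const).mul continuous_const
  have hopen := (Valued.isOpen_integer (𝔭.adicCompletion K)).preimage hcont
  have hdense : DenseRange (algebraMap K (𝔭.adicCompletion K)) := denseRange_algebraMap K 𝔭
  obtain ⟨k, hk⟩ := hdense.exists_mem_open hopen
    ⟨c, by simp⟩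
  refine ⟨k, ?_⟩
  have h1 : Valued.v ((algebraMap K (𝔭.adicCompletion K) k - c) * ρ⁻¹) ≤ 1 := hk
  rw [← valued_algebraMap]
  calc _ = Valued.v ((algebraMap K (𝔭.adicCompletion K) k - c) * ρ⁻¹) * Valued.v ρ := by
        rw [← map_mul, inv_mul_cancel_right₀ hρ]
    _ ≤ 1 * Valued.v ρ := by gcongr
    _ = _ := one_mul _

lemma finite_setOf_mem {r : R} (hr : r ≠ 0) : {𝔭 : HeightOneSpectrum R | r ∈ 𝔭.asIdeal}.Finite := by
  have := Ideal.finite_factors (I := Ideal.span {r}) (by simpa using hr)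
  simpa [Ideal.dvd_span_singleton] using this

/-- Strong approximation for the field of fractions of a Dedekind domain. -/
lemma exists_forall_valued_sub_le (T : Finset (HeightOneSpectrum R))
    (c : ∀ 𝔭 : HeightOneSpectrum R, 𝔭.adicCompletion K) {r : R} (hr : r ≠ 0) :
    ∃ k : K, (∀ 𝔭 ∈ T, Valued.v (algebraMap K (𝔭.adicCompletion K) k - c 𝔭) ≤
      𝔭.valuation K (algebraMap R K r)) ∧ ∀ 𝔭 ∉ T, 𝔭.valuation K k ≤ 1 := by
  classical
  have hrK : algebraMap R K r ≠ 0 := by simp [hr]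
  choose k hk using fun 𝔭 : HeightOneSpectrum R => exists_valued_sub_le 𝔭 (c 𝔭) hrK
  obtain ⟨b, hb⟩ := IsLocalization.exist_integer_multiples_of_finset (nonZeroDivisors R)
    (T.image k)
  have hb0 : (b : R) ≠ 0 := nonZeroDivisors.coe_ne_zero b
  have hbK : algebraMap R K b ≠ 0 := by simp
  have hb' : ∀ 𝔭 : T, ∃ a : R, algebraMap R K a = algebraMap R K b * k 𝔭 := fun 𝔭 => by
    obtain ⟨a, ha⟩ := hb _ (Finset.mem_image_of_mem k 𝔭.2)
    exact ⟨a, by rw [ha, Algebra.smul_def]⟩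
  choose a ha using hb'
  -- The approximant will be `y / b` with `y ∈ R`. At primes dividing `b` outside `T` integrality is
  -- not automatic, so there `y` is required to be close to 0.
  let F : Finset (HeightOneSpectrum R) := T ∪ (finite_setOf_mem hb0).toFinset
  -- Precision `r * b` for the numerator becomes precision `r` after division by `b`.
  have hpow : ∀ 𝔭 : HeightOneSpectrum R, ∃ n : ℕ, ∀ x ∈ 𝔭.asIdeal ^ n,
      𝔭.intValuation x ≤ 𝔭.intValuation (r * b) := by
    intro 𝔭
    have hrb : r * b ≠ 0 := mul_ne_zero hr hb0
    have h := 𝔭.intValuation_if_neg hrb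
    exact ⟨_, fun x hx => h ▸ (𝔭.intValuation_le_pow_iff_mem x _).2 hx⟩
  choose n hn using hpow
  obtain ⟨y, hy⟩ := IsDedekindDomain.exists_forall_sub_mem_ideal (s := F)
    (fun 𝔭 => 𝔭.asIdeal) n (fun 𝔭 _ => 𝔭.prime)
    (fun 𝔭 _ 𝔮 _ h h' => h (HeightOneSpectrum.ext h'))
    (fun 𝔭 => if h : 𝔭.1 ∈ T then a ⟨𝔭.1, h⟩ else 0)
  have hval : ∀ 𝔭 : HeightOneSpectrum R, ∀ z : R, 𝔭.intValuation z ≤ 𝔭.intValuation (r * b) →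
      𝔭.valuation K (algebraMap R K z / algebraMap R K b) ≤ 𝔭.valuation K (algebraMap R K r) := by
    intro 𝔭 z hz
    rw [map_div₀, div_le_iff₀ (by simp [zero_lt_iff]), ← map_mul, ← map_mul,
      valuation_of_algebraMap, valuation_of_algebraMap]
    exact hz
  refine ⟨algebraMap R K y / algebraMap R K b, fun 𝔭 h𝔭 => ?_, fun 𝔭 h𝔭 => ?_⟩
  · have h1 := hy 𝔭 (Finset.mem_union_left _ h𝔭)
    rw [dif_pos h𝔭] at h1
    have h2 := hval 𝔭 _ (hn 𝔭 _ h1)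
    rw [map_sub, ha, sub_div, mul_div_cancel_left₀ _ hbK, ← valued_algebraMap, map_sub] at h2
    have h3 := Valuation.map_add_le Valued.v h2 (hk 𝔭)
    rwa [sub_add_sub_cancel] at h3
  · by_cases hbp : (b : R) ∈ 𝔭.asIdeal
    · have h1 := hy 𝔭 (Finset.mem_union_right _ (by simp [hbp]))
      rw [dif_neg h𝔭, sub_zero] at h1
      exact (hval 𝔭 _ (hn 𝔭 _ h1)).trans (valuation_le_one _ _)
    · rw [map_div₀, (𝔭.valuation_eq_one_iff_notMem (K := K)).2 hbp, div_one]
      exact valuation_le_one _ _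

end IsDedekindDomain.HeightOneSpectrum

/-- A maximal ideal containing `I` is nonzero, hence is one of the `𝔭`. The condition `I ≠ ⊥` covers
the case of a field, where there is no `𝔭` at all. -/
lemma Ideal.eq_top_of_forall_not_le {R : Type*} [CommRing R] [IsDedekindDomain R] {I : Ideal R}
    (h0 : I ≠ ⊥) (h : ∀ 𝔭 : HeightOneSpectrum R, ∃ s ∈ I, s ∉ 𝔭.asIdeal) : I = ⊤ := by
  by_contra hI
  obtain ⟨M, hM, hIM⟩ := Ideal.exists_le_maximal I hI
  obtain ⟨s, hs, hsM⟩ := h ⟨M, hM.isPrime, fun h => h0 (le_bot_iff.1 (h ▸ hIM))⟩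
  exact hsM (hIM hs)

/-! ### Orders, their completions and local units -/

section CompletedOrder

variable {R : Type u} {K : Type v} {A : Type w} [CommRing R] [Field K] [Algebra R K]
  [Ring A] [Algebra K A] [Algebra R A] [IsScalarTower R K A]

namespace IsDGOrder

variable {D : DGAlgebra K A} {Λ : Subalgebra R A} (hΛ : IsDGOrder D Λ)
include hΛ

lemma finiteDimensional : FiniteDimensional K A := by
  obtain ⟨T, hT⟩ := (Subalgebra.toSubmodule Λ).fg_top.1 hΛ.finite.fg_top
  refine ⟨⟨T, ?_⟩⟩
  rw [← Submodule.span_span_of_tower R K, hT]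
  exact hΛ.span_eq_top

variable [IsDomain R] [IsFractionRing R K]

lemma exists_smul_mem (a : A) : ∃ s : R, s ≠ 0 ∧ s • a ∈ Λ := by
  have ha : a ∈ Submodule.span K (Λ : Set A) := hΛ.span_eq_top ▸ Submodule.mem_top
  induction ha using Submodule.span_induction with
  | mem x hx => exact ⟨1, one_ne_zero, by simpa using hx⟩
  | zero => exact ⟨1, one_ne_zero, by simp⟩
  | add x y _ _ hx hy =>
    obtain ⟨s, hs, h⟩ := hx
    obtain ⟨t, ht, h'⟩ := hy
    refine ⟨s * t, mul_ne_zero hs ht, ?_⟩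
    rw [smul_add]
    refine add_mem ?_ ?_
    · rw [mul_comm, mul_smul]; exact Λ.smul_mem h t
    · rw [mul_smul]; exact Λ.smul_mem h' s
  | smul k x _ hx =>
    obtain ⟨s, hs, h⟩ := hx
    obtain ⟨n, d, hd, rfl⟩ := IsFractionRing.div_surjective (A := R) k
    have hd0 := nonZeroDivisors.ne_zero hd
    refine ⟨d * s, mul_ne_zero hd0 hs, ?_⟩
    have : (d * s) • (algebraMap R K n / algebraMap R K d) • x = n • s • x := by
      rw [← algebraMap_smul K (d * s), ← algebraMap_smul K n, ← algebraMap_smul K s, smul_smul,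
        smul_smul, map_mul]
      congr 1
      have : algebraMap R K d ≠ 0 := by simpa using hd0
      field_simp
    rw [this]
    exact Λ.smul_mem h n

lemma exists_smul_mem_finset (T : Finset A) : ∃ s : R, s ≠ 0 ∧ ∀ a ∈ T, s • a ∈ Λ := by
  classical
  choose s hs h using hΛ.exists_smul_mem
  refine ⟨∏ a ∈ T, s a, Finset.prod_ne_zero_iff.2 fun a _ => hs a, fun a ha => ?_⟩
  rw [← Finset.prod_erase_mul _ _ ha, mul_smul]
  exact Λ.smul_mem (h a) _

/-- Coordinates on `A` with respect to a projective order. -/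
lemma exists_coordinates : ∃ (n : ℕ) (e : Fin n → A) (f : Fin n → A →ₗ[K] K),
    (∀ i, e i ∈ Λ) ∧ (∀ i, ∀ a ∈ Λ, ∃ r : R, algebraMap R K r = f i a) ∧
      ∀ a, a = ∑ i, f i a • e i := by
  have := hΛ.finite
  have := hΛ.projective
  -- `φ ∘ ψ = id` exhibits `Λ` as a direct summand of `Rⁿ`. As `A` is the localisation of `Λ` at the
  -- nonzero scalars, the coordinates of `ψ` extend to `K`-linear forms on `A`.
  obtain ⟨n, φ, ψ, -, -, h⟩ := Module.Finite.exists_comp_eq_id_of_projective R Λ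
  have hK : ∀ x : nonZeroDivisors R, IsUnit (algebraMap R (Module.End R K) x) := fun x => by
    have hx : algebraMap R K x ≠ 0 := by simp
    rw [Module.End.isUnit_iff]
    refine ⟨fun a b h => ?_, fun b => ⟨(algebraMap R K x)⁻¹ * b, ?_⟩⟩
    · simp only [Module.algebraMap_end_apply, Algebra.smul_def] at h
      exact mul_left_cancel₀ hx h
    · simp only [Module.algebraMap_end_apply, Algebra.smul_def]
      rw [mul_inv_cancel_left₀ hx]
  have hA : IsLocalizedModule (nonZeroDivisors R) Λ.val.toLinearMap := by
    refine ⟨fun x => ?_, fun a => ?_, fun {x y} h => ⟨1, by rw [Subtype.ext h]⟩⟩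
    · have hx : algebraMap R K x ≠ 0 := by simp
      rw [Module.End.isUnit_iff]
      refine ⟨fun a b h => ?_, fun b => ⟨(algebraMap R K x)⁻¹ • b, ?_⟩⟩
      · rw [Module.algebraMap_end_apply, Module.algebraMap_end_apply, ← algebraMap_smul K,
          ← algebraMap_smul K (x : R) b] at h
        exact smul_right_injective _ hx h
      · rw [Module.algebraMap_end_apply, ← algebraMap_smul K, smul_inv_smul₀ hx]
    · obtain ⟨s, hs, h⟩ := hΛ.exists_smul_mem a
      exact ⟨(⟨s • a, h⟩, ⟨s, mem_nonZeroDivisors_of_ne_zero hs⟩), rfl⟩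
  let g : Fin n → Λ →ₗ[R] K := fun i => Algebra.linearMap R K ∘ₗ LinearMap.proj i ∘ₗ ψ
  let f : Fin n → A →ₗ[K] K := fun i => LinearMap.extendScalarsOfIsLocalization
    (nonZeroDivisors R) K (IsLocalizedModule.lift (nonZeroDivisors R) Λ.val.toLinearMap (g i) hK)
  have hf : ∀ i (a : Λ), f i a = algebraMap R K (ψ a i) := fun i a =>
    IsLocalizedModule.lift_apply (nonZeroDivisors R) Λ.val.toLinearMap (g i) hK a
  refine ⟨n, fun i => φ (Pi.single i 1), f, fun i => SetLike.coe_mem _,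
    fun i a ha => ⟨_, (hf i ⟨a, ha⟩).symm⟩, fun a => ?_⟩
  have key : ∀ a : Λ, (a : A) = ∑ i, f i a • (φ (Pi.single i 1) : A) := by
    intro a
    have h1 := LinearMap.congr_fun h a
    simp only [LinearMap.comp_apply, LinearMap.id_apply] at h1
    rw [pi_eq_sum_univ' (ψ a), map_sum] at h1
    conv_lhs => rw [← h1]
    rw [AddSubmonoidClass.coe_finsetSum]
    refine Finset.sum_congr rfl fun i _ => ?_
    rw [hf, algebraMap_smul, map_smul]
    congr 4
  obtain ⟨s, hs, h⟩ := hΛ.exists_smul_mem a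
  have hs' : algebraMap R K s ≠ 0 := by simpa using hs
  have h1 := key ⟨s • a, h⟩
  simp only [← algebraMap_smul K s a, map_smul, smul_assoc, ← Finset.smul_sum] at h1
  exact smul_right_injective _ hs' h1

end IsDGOrder

variable [IsDedekindDomain R] [IsFractionRing R K] (Λ : Subalgebra R A)
  (𝔭 : HeightOneSpectrum R)

lemma tmul_mem_completedOrder {a : A} (ha : a ∈ Λ) :
    (1 : 𝔭.adicCompletion K) ⊗ₜ[K] a ∈ completedOrder K Λ 𝔭 :=
  Submodule.subset_span ⟨a, ha, rfl⟩

variable {Λ 𝔭}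

lemma smul_mem_completedOrder {c : 𝔭.adicCompletion K} (hc : Valued.v c ≤ 1)
    {x : completedAlgebra K A 𝔭} (hx : x ∈ completedOrder K Λ 𝔭) :
    c • x ∈ completedOrder K Λ 𝔭 :=
  (completedOrder K Λ 𝔭).smul_mem hx ⟨c, hc⟩

lemma smul_mem_completedOrder' {k : K} (hk : 𝔭.valuation K k ≤ 1)
    {x : completedAlgebra K A 𝔭} (hx : x ∈ completedOrder K Λ 𝔭) :
    k • x ∈ completedOrder K Λ 𝔭 := by
  rw [← algebraMap_smul (𝔭.adicCompletion K)]
  exact smul_mem_completedOrder ((HeightOneSpectrum.valued_algebraMap 𝔭 k).trans_le hk) hx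

lemma completedOrder_induction {P : completedAlgebra K A 𝔭 → Prop}
    (mem : ∀ a ∈ Λ, P (1 ⊗ₜ a)) (zero : P 0) (add : ∀ x y, P x → P y → P (x + y))
    (smul : ∀ (c : 𝔭.adicCompletion K) x, Valued.v c ≤ 1 → P x → P (c • x))
    {x : completedAlgebra K A 𝔭} (hx : x ∈ completedOrder K Λ 𝔭) : P x := by
  have hx' : x ∈ Submodule.span (𝔭.adicCompletionIntegers K)
    ((fun a : A => (1 : 𝔭.adicCompletion K) ⊗ₜ[K] a) '' (Λ : Set A)) := hx
  clear hx
  induction hx' using Submodule.span_induction with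
  | mem x hx => obtain ⟨a, ha, rfl⟩ := hx; exact mem a ha
  | zero => exact zero
  | add x y _ _ hx hy => exact add x y hx hy
  | smul s x _ hx => exact smul s x s.2 hx

namespace IsDGOrder

variable {D : DGAlgebra K A} (hΛ : IsDGOrder D Λ)
include hΛ

/-- This is `A ∩ Λ̂_℘ = Λ_℘`. The coordinate forms map `Λ` into `R`, so their extensions map `Λ̂_℘`
into the valuation ring; the coordinates of `a` are then fractions with denominators prime to `℘`,
which can be cleared together. -/
lemma exists_smul_mem_of_mem_completedOrder {a : A}
    (ha : (1 : 𝔭.adicCompletion K) ⊗ₜ[K] a ∈ completedOrder K Λ 𝔭) :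
    ∃ s : R, s ∉ 𝔭.asIdeal ∧ s • a ∈ Λ := by
  classical
  obtain ⟨n, e, f, he, hf, h⟩ := hΛ.exists_coordinates
  have h1 : ∀ i, 𝔭.valuation K (f i a) ≤ 1 := by
    intro i
    let F : completedAlgebra K A 𝔭 →ₗ[𝔭.adicCompletion K] 𝔭.adicCompletion K :=
      (TensorProduct.AlgebraTensorModule.rid K (𝔭.adicCompletion K)
        (𝔭.adicCompletion K)).toLinearMap ∘ₗ (f i).baseChange (𝔭.adicCompletion K)
    have hF : ∀ a, F (1 ⊗ₜ a) = algebraMap K _ (f i a) := fun a => by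
      simp [F, Algebra.algebraMap_eq_smul_one]
    have key : Valued.v (F (1 ⊗ₜ a)) ≤ 1 := by
      refine completedOrder_induction (P := fun x => Valued.v (F x) ≤ 1) ?_ ?_ ?_ ?_ ha
      · intro a ha
        obtain ⟨r, hr⟩ := hf i a ha
        rw [hF, HeightOneSpectrum.valued_algebraMap, ← hr]
        exact HeightOneSpectrum.valuation_le_one _ _
      · simp
      · intro x y hx hy
        rw [map_add]
        exact Valuation.map_add_le _ hx hy
      · intro c x hc hx
        rw [map_smul, smul_eq_mul, map_mul]
        exact mul_le_one' hc hx
    rwa [hF, HeightOneSpectrum.valued_algebraMap] at key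
  choose m d hd using fun i => 𝔭.exists_primeCompl_mul_eq_of_integer (f i a) (h1 i)
  refine ⟨∏ i, (d i : R), (Ideal.IsPrime.prod_mem_iff (p := 𝔭.asIdeal)).not.2
    (by push Not; exact fun i _ => (d i).2), ?_⟩
  rw [h a, Finset.smul_sum]
  refine sum_mem fun i _ => ?_
  have h2 : (∏ i, (d i : R)) • f i a • e i = ((∏ j ∈ Finset.univ.erase i, (d j : R)) * m i) • e i := by
    rw [← Finset.prod_erase_mul _ _ (Finset.mem_univ i), ← algebraMap_smul K (_ : R) (e i),
      ← algebraMap_smul K (_ : R) (_ • e i), smul_smul, map_mul, map_mul, ← hd, mul_assoc,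
      mul_comm (f i a)]
  rw [h2]
  exact Λ.smul_mem (he i) _

/-- The ideal of denominators of `a` with respect to `Λ` is nonzero and contained in no `𝔭`, hence
contains 1. -/
lemma mem_of_forall_mem_completedOrder {a : A}
    (ha : ∀ 𝔭 : HeightOneSpectrum R, (1 : 𝔭.adicCompletion K) ⊗ₜ[K] a ∈ completedOrder K Λ 𝔭) :
    a ∈ Λ := by
  let I : Ideal R := (Subalgebra.toSubmodule Λ).comap (LinearMap.toSpanSingleton R A a)
  have hI : ∀ s, s ∈ I ↔ s • a ∈ Λ := fun s => Iff.rfl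
  have htop : I = ⊤ := by
    refine Ideal.eq_top_of_forall_not_le ?_ fun 𝔭 => ?_
    · obtain ⟨s, hs, h⟩ := hΛ.exists_smul_mem a
      exact fun h0 => hs (by simpa [h0] using (hI s).2 h)
    · obtain ⟨s, hs, h⟩ := hΛ.exists_smul_mem_of_mem_completedOrder (ha 𝔭)
      exact ⟨s, h, hs⟩
  simpa using (hI 1).1 (htop ▸ Submodule.mem_top)

omit hΛ in
lemma exists_smul_valued_le_one (c : 𝔭.adicCompletion K) :
    ∃ r : R, r ≠ 0 ∧ Valued.v (algebraMap K _ (algebraMap R K r) * c) ≤ 1 := by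
  obtain ⟨b, hb, h⟩ :=
    HeightOneSpectrum.adicCompletion.mul_nonZeroDivisor_mem_adicCompletionIntegers 𝔭 c
  refine ⟨b, nonZeroDivisors.ne_zero hb, ?_⟩
  rw [mul_comm]
  exact h

lemma exists_smul_mem_completedOrder (x : completedAlgebra K A 𝔭) :
    ∃ r : R, r ≠ 0 ∧ algebraMap R K r • x ∈ completedOrder K Λ 𝔭 := by
  induction x using TensorProduct.induction_on with
  | zero => exact ⟨1, one_ne_zero, by simp⟩
  | tmul c a =>
    obtain ⟨r, hr, h⟩ := exists_smul_valued_le_one c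
    obtain ⟨s, hs, h'⟩ := hΛ.exists_smul_mem a
    refine ⟨r * s, mul_ne_zero hr hs, ?_⟩
    have h2 := smul_mem_completedOrder h (tmul_mem_completedOrder Λ 𝔭 h')
    rw [TensorProduct.smul_tmul', smul_eq_mul, mul_one, ← algebraMap_smul K s a,
      ← TensorProduct.smul_tmul, ← Algebra.smul_def, smul_smul, mul_comm, ← map_mul] at h2
    rwa [TensorProduct.smul_tmul']
  | add x y hx hy =>
    obtain ⟨r, hr, h⟩ := hx
    obtain ⟨s, hs, h'⟩ := hy
    refine ⟨r * s, mul_ne_zero hr hs, ?_⟩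
    rw [smul_add, map_mul]
    refine add_mem ?_ ?_
    · rw [mul_comm, mul_smul]
      exact smul_mem_completedOrder' (HeightOneSpectrum.valuation_le_one _ _) h
    · rw [mul_smul]
      exact smul_mem_completedOrder' (HeightOneSpectrum.valuation_le_one _ _) h'

lemma isArtinianRing : IsArtinianRing A :=
  have := hΛ.finiteDimensional
  IsArtinianRing.of_finite K A

lemma isArtinianRing_completedAlgebra : IsArtinianRing (completedAlgebra K A 𝔭) :=
  have := hΛ.finiteDimensional
  IsArtinianRing.of_finite (𝔭.adicCompletion K) (completedAlgebra K A 𝔭)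

/-- The finiteness needed for Nakayama's lemma in `exists_inverse_one_add`; generators of `Λ` over
`R` suffice. -/
lemma completedOrder_fg : (Subalgebra.toSubmodule (completedOrder K Λ 𝔭)).FG := by
  classical
  obtain ⟨T, hT⟩ := (Subalgebra.toSubmodule Λ).fg_top.1 hΛ.finite.fg_top
  refine ⟨T.image fun a => (1 : 𝔭.adicCompletion K) ⊗ₜ[K] a, le_antisymm ?_ ?_⟩
  · rw [Submodule.span_le, Finset.coe_image]
    rintro _ ⟨a, ha, rfl⟩
    refine tmul_mem_completedOrder Λ 𝔭 ?_
    change a ∈ Subalgebra.toSubmodule Λ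
    rw [← hT]
    exact Submodule.subset_span ha
  · refine Submodule.span_le.2 ?_
    rintro _ ⟨a, ha, rfl⟩
    have ha' : a ∈ Submodule.span R (T : Set A) := hT ▸ ha
    simp only [SetLike.mem_coe]
    clear ha
    induction ha' using Submodule.span_induction with
    | mem x hx => exact Submodule.subset_span (by simpa using ⟨x, hx, rfl⟩)
    | zero => simp
    | add x y _ _ hx hy => rw [TensorProduct.tmul_add]; exact add_mem hx hy
    | smul r x _ hx =>
      rw [← algebraMap_smul K r x, ← TensorProduct.smul_tmul, Algebra.smul_def, mul_one]
      have h1 := Submodule.smul_mem _ (algebraMap R (𝔭.adicCompletionIntegers K) r) hx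
      rwa [Algebra.smul_def, Algebra.TensorProduct.algebraMap_apply,
        Algebra.TensorProduct.tmul_mul_tmul, mul_one, one_mul] at h1

/-- Elements congruent to `1` modulo the prime are invertible in the completed order. -/
lemma exists_inverse_one_add {k : K} (hk : 𝔭.valuation K k < 1) {z : completedAlgebra K A 𝔭}
    (hz : z ∈ completedOrder K Λ 𝔭) :
    ∃ l ∈ completedOrder K Λ 𝔭, l * (1 + k • z) = 1 ∧ (1 + k • z) * l = 1 := by
  let N := Subalgebra.toSubmodule (completedOrder K Λ 𝔭)
  let N' := N.map (LinearMap.mulRight (𝔭.adicCompletionIntegers K) (1 + k • z))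
  let κ : 𝔭.adicCompletionIntegers K := ⟨algebraMap K _ k,
    ((HeightOneSpectrum.valued_algebraMap 𝔭 k).trans_lt hk).le⟩
  have hκ : κ ∈ IsLocalRing.maximalIdeal (𝔭.adicCompletionIntegers K) := by
    rw [IsLocalRing.mem_maximalIdeal, mem_nonunits_iff,
      HeightOneSpectrum.adicCompletionIntegers.isUnit_iff_valued_eq_one]
    exact ((HeightOneSpectrum.valued_algebraMap 𝔭 k).trans_lt hk).ne
  -- Nakayama: with `u = 1 + k • z`, every `l` equals `l * u - k • (l * z)`, so `N` is contained in
  -- `N u` plus the maximal ideal times `N`. Hence `N ≤ N u`, and 1 has the form `l * u`.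
  have hle : N ≤ N' := by
    refine Submodule.le_of_le_smul_of_le_jacobson_bot hΛ.completedOrder_fg
      (IsLocalRing.jacobson_eq_maximalIdeal _ bot_ne_top).ge fun l hl => ?_
    have h1 : l = l * (1 + k • z) + κ • (-(l * z)) := by
      have h2 : κ • (-(l * z)) = k • (-(l * z)) := algebraMap_smul (𝔭.adicCompletion K) k (-(l * z))
      rw [h2, mul_add, mul_one, mul_smul_comm, smul_neg, add_neg_cancel_right]
    rw [h1]
    exact Submodule.add_mem_sup ⟨l, hl, rfl⟩
      (Submodule.smul_mem_smul hκ (neg_mem ((completedOrder K Λ 𝔭).mul_mem hl hz)))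
  obtain ⟨l, hl, h⟩ := hle (one_mem (completedOrder K Λ 𝔭))
  have h' : l * (1 + k • z) = 1 := h
  -- In an artinian ring a one-sided inverse is two-sided.
  have := hΛ.isArtinianRing_completedAlgebra (𝔭 := 𝔭)
  exact ⟨l, hl, h', mul_eq_one_symm h'⟩

lemma mem_completedOrderUnits_of_eq_one_add {u : (completedAlgebra K A 𝔭)ˣ} {k : K}
    (hk : 𝔭.valuation K k < 1) {z : completedAlgebra K A 𝔭} (hz : z ∈ completedOrder K Λ 𝔭)
    (hu : (u : completedAlgebra K A 𝔭) = 1 + k • z) : u ∈ completedOrderUnits Λ 𝔭 := by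
  obtain ⟨l, hl, h1, h2⟩ := hΛ.exists_inverse_one_add hk hz
  rw [← hu] at h1 h2
  refine (Submonoid.mem_units_iff _ _).2 ⟨?_, ?_⟩
  · rw [hu]
    exact add_mem (S := Subalgebra _ _) (one_mem _) (smul_mem_completedOrder' hk.le hz)
  · rwa [← Units.eq_inv_of_mul_eq_one_left h2]

end IsDGOrder

end CompletedOrder

/-! ### Homogeneous units and cycles of degree 0 -/

namespace DGAlgebra

variable {R : Type u} {B : Type w} [CommRing R] [Ring B] [Algebra R B] (D : DGAlgebra R B)

/-- The cycles of degree `0`. -/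
def zeroCycles : Submodule R B := D.gr 0 ⊓ LinearMap.ker D.d

variable {D}

/-- Homogeneous units of an algebra of finite type as a module have degree `0`. -/
lemma mem_gr_zero_of_isUnit [IsNoetherian R B] (x : Bˣ)
    (hx : SetLike.IsHomogeneousElem D.gr (x : B)) : (x : B) ∈ D.gr 0 := by
  rcases subsingleton_or_nontrivial B with hB | hB
  · rw [Subsingleton.elim (x : B) 0]
    exact zero_mem _
  obtain ⟨k, hk⟩ := hx
  by_contra h
  have hk0 : k ≠ 0 := by rintro rfl; exact h hk
  -- Only finitely many degrees occur, whereas for `k ≠ 0` the nonzero powers `x ^ n` would occupy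
  -- the infinitely many degrees `n • k`.
  have hfin : {i | D.gr i ≠ ⊥}.Finite := WellFoundedGT.finite_ne_bot_of_iSupIndep
    (DirectSum.Decomposition.isInternal D.gr).submodule_iSupIndep
  refine Set.infinite_of_injective_forall_mem (f := fun n : ℕ => n • k) ?_ (fun n => ?_) hfin
  · intro m n hmn
    simpa [hk0] using hmn
  · intro h0
    have h1 := SetLike.pow_mem_graded n hk
    rw [h0, Submodule.mem_bot, ← Units.val_pow_eq_pow_val] at h1
    exact (x ^ n).ne_zero h1

lemma val_mem_zeroCycles [IsNoetherian R B] {x : Bˣ} (hx : x ∈ D.cycleUnits) :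
    (x : B) ∈ D.zeroCycles :=
  ⟨mem_gr_zero_of_isUnit x hx.1, hx.2⟩

lemma mem_cycleUnits_of_mem_zeroCycles {x : Bˣ} (hx : (x : B) ∈ D.zeroCycles) :
    x ∈ D.cycleUnits :=
  ⟨⟨0, hx.1⟩, hx.2⟩

/-- Cycles of degree `0` in a flat base change come from cycles of degree `0`. -/
lemma mem_range_baseChange_zeroCycles (S : Type v) [CommRing S] [Algebra R S] [Module.Flat R S]
    {x : S ⊗[R] B} (hx : x ∈ (D.baseChange S).zeroCycles) :
    x ∈ LinearMap.range (D.zeroCycles.subtype.baseChange S) := by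
  obtain ⟨h0, hd⟩ := hx
  have h0' : x ∈ (D.gr 0).baseChange S := h0
  have hd' : D.d.baseChange S x = 0 := hd
  obtain ⟨y, rfl⟩ := h0'
  let ι : D.zeroCycles →ₗ[R] D.gr 0 := Submodule.inclusion inf_le_left
  -- Degree-0 cycles are the kernel of `d` on the degree-0 part, and flat base change preserves this
  -- kernel.
  have hex : Function.Exact ι (D.d ∘ₗ (D.gr 0).subtype) := by
    intro a
    refine ⟨fun h => ⟨⟨a, a.2, h⟩, rfl⟩, ?_⟩
    rintro ⟨b, rfl⟩
    exact b.2.2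
  have h1 := (Module.Flat.lTensor_exact S hex y).1 (by
    rw [LinearMap.lTensor_comp]
    exact hd')
  obtain ⟨z, rfl⟩ := h1
  refine ⟨z, ?_⟩
  have : D.zeroCycles.subtype = (D.gr 0).subtype ∘ₗ ι := rfl
  rw [this, LinearMap.baseChange_comp]
  rfl

end DGAlgebra

/-! ### Approximating idèles by global units -/

section Approximation

variable {R : Type u} {K : Type v} {A : Type w} [CommRing R] [Field K] [Algebra R K]
  [Ring A] [Algebra K A] [Algebra R A] [IsScalarTower R K A]
  [IsDedekindDomain R] [IsFractionRing R K]
  {D : DGAlgebra K A} {Λ : Subalgebra R A} (hΛ : IsDGOrder D Λ)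

namespace IsDGOrder
include hΛ

/-- A `K`-basis of the degree-0 cycles of `A`, scaled into `Λ`, spans the degree-0 cycles of every
completion by flatness. Having one family in `Λ` for all primes turns approximation of cycles into
approximation of scalars. -/
lemma exists_generators_zeroCycles : ∃ (n : ℕ) (z : Fin n → A),
    (∀ i, z i ∈ Λ) ∧ (∀ i, z i ∈ D.zeroCycles) ∧
    ∀ (𝔭 : HeightOneSpectrum R), ∀ x ∈ (D.baseChange (𝔭.adicCompletion K)).zeroCycles,
      ∃ c : Fin n → 𝔭.adicCompletion K, x = ∑ i, c i ⊗ₜ z i := by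
  classical
  have := hΛ.finiteDimensional
  let b := Module.finBasis K D.zeroCycles
  obtain ⟨s, hs, h⟩ := hΛ.exists_smul_mem_finset (Finset.univ.image fun i => (b i : A))
  have hsK : algebraMap R K s ≠ 0 := by simpa using hs
  refine ⟨_, fun i => s • (b i : A), fun i => h _ (by simp), fun i => ?_, fun 𝔭 x hx => ?_⟩
  · change s • (b i : A) ∈ D.zeroCycles
    rw [← algebraMap_smul K s]
    exact D.zeroCycles.smul_mem _ (b i).2
  · obtain ⟨y, rfl⟩ := DGAlgebra.mem_range_baseChange_zeroCycles _ hx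
    let b' := b.baseChange (𝔭.adicCompletion K)
    refine ⟨fun i => (algebraMap R K s)⁻¹ • b'.repr y i, ?_⟩
    conv_lhs => rw [← b'.sum_repr y, map_sum]
    refine Finset.sum_congr rfl fun i _ => ?_
    beta_reduce
    rw [map_smul, ← algebraMap_smul K s (b i : A), ← TensorProduct.smul_tmul, smul_inv_smul₀ hsK]
    simp [b', TensorProduct.smul_tmul']

/-- Strong approximation for cycles of degree `0`. -/
lemma exists_zeroCycle_approx (T : Finset (HeightOneSpectrum R))
    (x : ∀ 𝔭 : HeightOneSpectrum R, completedAlgebra K A 𝔭)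
    (hx : ∀ 𝔭, x 𝔭 ∈ (D.baseChange (𝔭.adicCompletion K)).zeroCycles) {r : R} (hr : r ≠ 0) :
    ∃ y ∈ D.zeroCycles, (∀ 𝔭 ∈ T, ∃ w ∈ completedOrder K Λ 𝔭,
      (1 : 𝔭.adicCompletion K) ⊗ₜ[K] y = x 𝔭 + algebraMap R K r • w) ∧
      ∀ 𝔭 ∉ T, (1 : 𝔭.adicCompletion K) ⊗ₜ[K] y ∈ completedOrder K Λ 𝔭 := by
  obtain ⟨n, z, hzΛ, hz, h⟩ := hΛ.exists_generators_zeroCycles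
  choose c hc using fun 𝔭 => h 𝔭 (x 𝔭) (hx 𝔭)
  choose k hk hk' using fun i => HeightOneSpectrum.exists_forall_valued_sub_le T
    (fun 𝔭 => c 𝔭 i) hr
  have hrK : algebraMap R K r ≠ 0 := by simpa using hr
  refine ⟨∑ i, k i • z i, sum_mem fun i _ => D.zeroCycles.smul_mem _ (hz i),
    fun 𝔭 h𝔭 => ?_, fun 𝔭 h𝔭 => ?_⟩
  · let ρ := algebraMap K (𝔭.adicCompletion K) (algebraMap R K r)
    have hρ : ρ ≠ 0 := by simpa [ρ] using hr
    -- The coordinate errors divided by `r` are integral, and the generators lie in `Λ`, so the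
    -- total error lies in `r Λ̂_℘`.
    let w : Fin n → 𝔭.adicCompletion K := fun i => ρ⁻¹ * (algebraMap K _ (k i) - c 𝔭 i)
    have hw : ∀ i, Valued.v (w i) ≤ 1 := fun i => by
      rw [map_mul, map_inv₀, inv_mul_le_iff₀ (by simpa [zero_lt_iff] using hρ), mul_one,
        HeightOneSpectrum.valued_algebraMap]
      exact hk i 𝔭 h𝔭
    refine ⟨∑ i, w i • (1 ⊗ₜ z i), sum_mem fun i _ => smul_mem_completedOrder (hw i)
      (tmul_mem_completedOrder Λ 𝔭 (hzΛ i)), ?_⟩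
    rw [hc 𝔭, Finset.smul_sum, ← Finset.sum_add_distrib, TensorProduct.tmul_sum]
    refine Finset.sum_congr rfl fun i _ => ?_
    have : algebraMap R K r • w i = algebraMap K _ (k i) - c 𝔭 i := by
      rw [Algebra.smul_def]
      exact mul_inv_cancel_left₀ hρ _
    rw [TensorProduct.smul_tmul', smul_eq_mul, mul_one, TensorProduct.smul_tmul', this,
      ← TensorProduct.add_tmul, add_sub_cancel, ← TensorProduct.smul_tmul, Algebra.smul_def,
      mul_one]
  · rw [TensorProduct.tmul_sum]
    refine sum_mem fun i _ => ?_
    rw [TensorProduct.tmul_smul]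
    exact smul_mem_completedOrder' (hk' i 𝔭 h𝔭) (tmul_mem_completedOrder Λ 𝔭 (hzΛ i))

omit hΛ in
lemma tmul_injective (𝔭 : HeightOneSpectrum R) :
    Function.Injective fun a : A => (1 : 𝔭.adicCompletion K) ⊗ₜ[K] a :=
  Algebra.TensorProduct.includeRight_injective (algebraMap K (𝔭.adicCompletion K)).injective

/-- Left multiplication by `a` is injective because it is so after completion; finite dimension
makes it surjective, and the resulting right inverse is two-sided in the artinian ring `A`. -/
lemma isUnit_of_isUnit_tmul {𝔭 : HeightOneSpectrum R} {a : A}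
    (h : IsUnit ((1 : 𝔭.adicCompletion K) ⊗ₜ[K] a)) : IsUnit a := by
  have := hΛ.finiteDimensional
  have := hΛ.isArtinianRing
  have hinj : Function.Injective (LinearMap.mulLeft K a) := by
    intro x y hxy
    apply tmul_injective (R := R) (K := K) 𝔭
    apply h.mul_right_injective
    have h1 := congrArg (fun a : A => (1 : 𝔭.adicCompletion K) ⊗ₜ[K] a) hxy
    simpa using h1
  obtain ⟨b, hb⟩ := LinearMap.injective_iff_surjective.1 hinj 1
  exact IsUnit.of_mul_eq_one b hb

/-- An extra factor from `𝔭` puts `r` itself into `𝔭`, so that elements `1 + r • z` with `z` in the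
completed order are invertible there. -/
lemma exists_common_denominator (𝔭 : HeightOneSpectrum R)
    (C : Finset (completedAlgebra K A 𝔭)) :
    ∃ r : R, r ≠ 0 ∧ r ∈ 𝔭.asIdeal ∧
      ∀ x ∈ C, algebraMap R K r • x ∈ completedOrder K Λ 𝔭 := by
  classical
  obtain ⟨π, hπ, hπ0⟩ := Submodule.exists_mem_ne_zero_of_ne_bot 𝔭.ne_bot
  choose r hr h using hΛ.exists_smul_mem_completedOrder (𝔭 := 𝔭)
  refine ⟨π * ∏ x ∈ C, r x, mul_ne_zero hπ0 (Finset.prod_ne_zero_iff.2 fun x _ => hr x),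
    Ideal.mul_mem_right _ _ hπ, fun x hx => ?_⟩
  rw [← Finset.prod_erase_mul _ _ hx, ← mul_assoc, map_mul, mul_smul]
  exact smul_mem_completedOrder' (HeightOneSpectrum.valuation_le_one _ _) (h x)

omit hΛ in
-- This explains the precision `r ^ 3`: two factors absorb the denominators of `c` and `d`, and the
-- third remains in `1 + r • z`. The factor `t` collects the contributions of other primes.
lemma mul_tmul_mul_eq {𝔭 : HeightOneSpectrum R} {c d ξ w : completedAlgebra K A 𝔭}
    {y : A} {r t : R} (h1 : c * ξ * d = 1)
    (hy : (1 : 𝔭.adicCompletion K) ⊗ₜ[K] y = ξ + algebraMap R K (r ^ 3 * t) • w)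
    (hc : algebraMap R K r • c ∈ completedOrder K Λ 𝔭)
    (hd : algebraMap R K r • d ∈ completedOrder K Λ 𝔭) (hw : w ∈ completedOrder K Λ 𝔭) :
    ∃ z ∈ completedOrder K Λ 𝔭, c * ((1 : 𝔭.adicCompletion K) ⊗ₜ[K] y) * d =
      1 + algebraMap R K r • z := by
  refine ⟨algebraMap R K t • ((algebraMap R K r • c) * w * (algebraMap R K r • d)),
    smul_mem_completedOrder' (HeightOneSpectrum.valuation_le_one _ _)
      (mul_mem (mul_mem hc hw) hd), ?_⟩
  rw [hy, mul_add, add_mul, h1]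
  congr 1
  simp only [mul_smul_comm, smul_mul_assoc, smul_smul]
  congr 1
  simp only [map_mul, map_pow]
  ring

end IsDGOrder

variable (K) in
/-- The embedding `A^× → Â_℘^×`. -/
noncomputable abbrev unitsToCompleted (𝔭 : HeightOneSpectrum R) : Aˣ →* (completedAlgebra K A 𝔭)ˣ :=
  Units.map (Algebra.TensorProduct.includeRight : A →ₐ[K] completedAlgebra K A 𝔭).toMonoidHom

lemma coe_unitsToCompleted (𝔭 : HeightOneSpectrum R) (y : Aˣ) :
    (unitsToCompleted K 𝔭 y : completedAlgebra K A 𝔭) = (1 : 𝔭.adicCompletion K) ⊗ₜ[K] (y : A) :=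
  rfl

lemma mem_completedOrderUnits {𝔭 : HeightOneSpectrum R} {u : (completedAlgebra K A 𝔭)ˣ} :
    u ∈ completedOrderUnits Λ 𝔭 ↔ (u : completedAlgebra K A 𝔭) ∈ completedOrder K Λ 𝔭 ∧
      ((u⁻¹ : (completedAlgebra K A 𝔭)ˣ) : completedAlgebra K A 𝔭) ∈ completedOrder K Λ 𝔭 :=
  Submonoid.mem_units_iff _ _

include hΛ in
-- Each of the three products is `c * y * d` with `c * ξ * d = 1`, so a close enough `y` makes it
-- congruent to 1. The third one, conjugated by `α`, is needed because idèles need not commute.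
lemma IsDGOrder.exists_cycleUnit_approx_of_nonempty (α ξ : ideleGroup D Λ)
    (T : Finset (HeightOneSpectrum R)) (hT : T.Nonempty) :
    ∃ y ∈ D.cycleUnits,
      (∀ 𝔭 ∈ T, (ξ.1 𝔭)⁻¹ * unitsToCompleted K 𝔭 y ∈ completedOrderUnits Λ 𝔭 ∧
        unitsToCompleted K 𝔭 y * (ξ.1 𝔭)⁻¹ ∈ completedOrderUnits Λ 𝔭 ∧
        α.1 𝔭 * (ξ.1 𝔭)⁻¹ * unitsToCompleted K 𝔭 y * (α.1 𝔭)⁻¹ ∈ completedOrderUnits Λ 𝔭) ∧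
      ∀ 𝔭 ∉ T, (1 : 𝔭.adicCompletion K) ⊗ₜ[K] (y : A) ∈ completedOrder K Λ 𝔭 := by
  classical
  have := hΛ.finiteDimensional
  have hcd := fun 𝔭 : HeightOneSpectrum R => hΛ.exists_common_denominator 𝔭
    {1, (((ξ.1 𝔭)⁻¹ : (completedAlgebra K A 𝔭)ˣ) : completedAlgebra K A 𝔭),
      ((α.1 𝔭 * (ξ.1 𝔭)⁻¹ : (completedAlgebra K A 𝔭)ˣ) : completedAlgebra K A 𝔭),
      (((α.1 𝔭)⁻¹ : (completedAlgebra K A 𝔭)ˣ) : completedAlgebra K A 𝔭)}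
  choose r hr0 hr𝔭 hr using hcd
  obtain ⟨y, hy, hyT, hyT'⟩ := hΛ.exists_zeroCycle_approx T (fun 𝔭 => ξ.1 𝔭)
    (fun 𝔭 => DGAlgebra.val_mem_zeroCycles (ξ.2.1 𝔭))
    (Finset.prod_ne_zero_iff.2 fun 𝔭 (_ : 𝔭 ∈ T) => pow_ne_zero 3 (hr0 𝔭))
  have hval : ∀ 𝔭 : HeightOneSpectrum R, 𝔭.valuation K (algebraMap R K (r 𝔭)) < 1 := fun 𝔭 =>
    (HeightOneSpectrum.valuation_lt_one_iff_mem _ _).2 (hr𝔭 𝔭)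
  have key : ∀ 𝔭 ∈ T, ∀ c d : completedAlgebra K A 𝔭,
      algebraMap R K (r 𝔭) • c ∈ completedOrder K Λ 𝔭 →
      algebraMap R K (r 𝔭) • d ∈ completedOrder K Λ 𝔭 → c * ξ.1 𝔭 * d = 1 →
      ∃ z ∈ completedOrder K Λ 𝔭, c * ((1 : 𝔭.adicCompletion K) ⊗ₜ[K] y) * d =
        1 + algebraMap R K (r 𝔭) • z := by
    intro 𝔭 h𝔭 c d hc hd h1
    obtain ⟨w, hw, h⟩ := hyT 𝔭 h𝔭
    rw [← Finset.mul_prod_erase _ _ h𝔭] at h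
    exact IsDGOrder.mul_tmul_mul_eq h1 h hc hd hw
  -- Invertibility of `y` over `A` can be detected at a single prime of `T`; this is where `T` must
  -- be nonempty.
  have hunit : IsUnit y := by
    obtain ⟨𝔭, h𝔭⟩ := hT
    obtain ⟨z, hz, h⟩ := key 𝔭 h𝔭 (((ξ.1 𝔭)⁻¹ : (completedAlgebra K A 𝔭)ˣ) : completedAlgebra K A 𝔭) 1
      (hr 𝔭 _ (by simp)) (hr 𝔭 _ (by simp))
      (by rw [Units.inv_mul, mul_one])
    obtain ⟨l, -, h1, h2⟩ := hΛ.exists_inverse_one_add (hval 𝔭) hz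
    have h3 : IsUnit (1 + algebraMap R K (r 𝔭) • z) := ⟨⟨_, l, h2, h1⟩, rfl⟩
    rw [← h, mul_one, Units.isUnit_units_mul] at h3
    exact hΛ.isUnit_of_isUnit_tmul h3
  obtain ⟨y, rfl⟩ := hunit
  refine ⟨y, DGAlgebra.mem_cycleUnits_of_mem_zeroCycles hy, fun 𝔭 h𝔭 => ⟨?_, ?_, ?_⟩, hyT'⟩
  · obtain ⟨z, hz, h⟩ := key 𝔭 h𝔭 (((ξ.1 𝔭)⁻¹ : (completedAlgebra K A 𝔭)ˣ) : completedAlgebra K A 𝔭) 1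
      (hr 𝔭 _ (by simp)) (hr 𝔭 _ (by simp))
      (by rw [Units.inv_mul, mul_one])
    refine hΛ.mem_completedOrderUnits_of_eq_one_add (hval 𝔭) hz ?_
    rw [← h, mul_one]
    rfl
  · obtain ⟨z, hz, h⟩ := key 𝔭 h𝔭 1 (((ξ.1 𝔭)⁻¹ : (completedAlgebra K A 𝔭)ˣ) : completedAlgebra K A 𝔭)
      (hr 𝔭 _ (by simp)) (hr 𝔭 _ (by simp))
      (by rw [one_mul, Units.mul_inv])
    refine hΛ.mem_completedOrderUnits_of_eq_one_add (hval 𝔭) hz ?_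
    rw [← h, one_mul]
    rfl
  · obtain ⟨z, hz, h⟩ := key 𝔭 h𝔭 ((α.1 𝔭 * (ξ.1 𝔭)⁻¹ : (completedAlgebra K A 𝔭)ˣ) : completedAlgebra K A 𝔭)
      (((α.1 𝔭)⁻¹ : (completedAlgebra K A 𝔭)ˣ) : completedAlgebra K A 𝔭)
      (hr 𝔭 _ (by simp)) (hr 𝔭 _ (by simp)) (by rw [← Units.val_mul, ← Units.val_mul]; simp)
    refine hΛ.mem_completedOrderUnits_of_eq_one_add (hval 𝔭) hz ?_
    rw [← h]
    rfl

include hΛ in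
/-- Strong approximation of idèles by global units, at finitely many primes. -/
lemma IsDGOrder.exists_cycleUnit_approx (α ξ : ideleGroup D Λ)
    (T : Finset (HeightOneSpectrum R)) (hξ : ∀ 𝔭 ∉ T, ξ.1 𝔭 ∈ completedOrderUnits Λ 𝔭) :
    ∃ y ∈ D.cycleUnits,
      (∀ 𝔭 ∈ T, (ξ.1 𝔭)⁻¹ * unitsToCompleted K 𝔭 y ∈ completedOrderUnits Λ 𝔭 ∧
        unitsToCompleted K 𝔭 y * (ξ.1 𝔭)⁻¹ ∈ completedOrderUnits Λ 𝔭 ∧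
        α.1 𝔭 * (ξ.1 𝔭)⁻¹ * unitsToCompleted K 𝔭 y * (α.1 𝔭)⁻¹ ∈ completedOrderUnits Λ 𝔭) ∧
      ∀ 𝔭 ∉ T, (1 : 𝔭.adicCompletion K) ⊗ₜ[K] (y : A) ∈ completedOrder K Λ 𝔭 := by
  classical
  rcases isEmpty_or_nonempty (HeightOneSpectrum R) with h | ⟨⟨𝔮⟩⟩
  · exact ⟨1, one_mem _, fun 𝔭 => h.elim 𝔭, fun 𝔭 => h.elim 𝔭⟩
  -- The auxiliary prime `𝔮` only serves to make the set nonempty. If `𝔮 ∉ T`, then `ξ` is a local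
  -- unit there, so `y`, being close to it, is still integral.
  obtain ⟨y, hy, h1, h2⟩ := hΛ.exists_cycleUnit_approx_of_nonempty α ξ (insert 𝔮 T)
    (Finset.insert_nonempty _ _)
  refine ⟨y, hy, fun 𝔭 h𝔭 => h1 𝔭 (Finset.mem_insert_of_mem h𝔭), fun 𝔭 h𝔭 => ?_⟩
  by_cases h : 𝔭 ∈ insert 𝔮 T
  · have h3 := mul_mem (hξ 𝔭 h𝔭) (h1 𝔭 h).1
    rw [mul_inv_cancel_left] at h3
    exact (mem_completedOrderUnits.1 h3).1
  · exact h2 𝔭 h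

end Approximation

/-! ### Modules of idèles and their local generators -/

section Ideles

variable {R : Type u} {K : Type v} {A : Type w} [CommRing R] [Field K] [Algebra R K]
  [Ring A] [Algebra K A] [Algebra R A] [IsScalarTower R K A]
  [IsDedekindDomain R] [IsFractionRing R K]
  {D : DGAlgebra K A} {Λ : Subalgebra R A} (hΛ : IsDGOrder D Λ)

lemma mem_ideleSubmodule {α : ideleGroup D Λ} {a : A} : a ∈ ideleSubmodule α ↔
    ∀ 𝔭 : HeightOneSpectrum R, (1 : 𝔭.adicCompletion K) ⊗ₜ[K] a *
      (((α.1 𝔭)⁻¹ : (completedAlgebra K A 𝔭)ˣ) : completedAlgebra K A 𝔭) ∈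
        completedOrder K Λ 𝔭 := by
  refine forall_congr' fun 𝔭 => ⟨?_, fun h => ⟨_, h, by rw [Units.inv_mul_cancel_right]⟩⟩
  rintro ⟨x, hx, h⟩
  rwa [h, Units.mul_inv_cancel_right]

lemma finite_setOf_notMem_completedOrderUnits (α : ideleGroup D Λ) :
    {𝔭 | α.1 𝔭 ∉ completedOrderUnits Λ 𝔭}.Finite := α.2.2

lemma tmul_mul_unitsToCompleted
    (𝔭 : HeightOneSpectrum R) (a : A) (y : Aˣ) :
    (1 : 𝔭.adicCompletion K) ⊗ₜ[K] (a * y) =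
      (1 : 𝔭.adicCompletion K) ⊗ₜ[K] a * (unitsToCompleted K 𝔭 y : completedAlgebra K A 𝔭) := by
  rw [coe_unitsToCompleted, Algebra.TensorProduct.tmul_mul_tmul, one_mul]

lemma tmul_mem_completedOrder_of_smul_mem {𝔭 : HeightOneSpectrum R} {a : A} {s : R}
    (hs : s ∉ 𝔭.asIdeal) (h : s • a ∈ Λ) :
    (1 : 𝔭.adicCompletion K) ⊗ₜ[K] a ∈ completedOrder K Λ 𝔭 := by
  have h1 : 𝔭.valuation K (algebraMap R K s) = 1 :=
    (HeightOneSpectrum.valuation_eq_one_iff_notMem _).2 hs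
  have h0 : algebraMap R K s ≠ 0 := by
    rintro h0
    rw [h0, map_zero] at h1
    exact zero_ne_one h1
  have h2 := smul_mem_completedOrder' (k := (algebraMap R K s)⁻¹) (by rw [map_inv₀, h1, inv_one])
    (tmul_mem_completedOrder Λ 𝔭 h)
  rwa [← algebraMap_smul K s a, ← TensorProduct.tmul_smul, inv_smul_smul₀ h0] at h2

lemma mul_mem_ideleSubmodule {α : ideleGroup D Λ} {l a : A} (hl : l ∈ Λ)
    (ha : a ∈ ideleSubmodule α) : l * a ∈ ideleSubmodule α :=
  (ideleSubmodule α).smul_mem ⟨l, hl⟩ ha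

namespace IsDGOrder
include hΛ

/-- Integral multiples of idèles. -/
lemma exists_smul_idele_mem (α : ideleGroup D Λ) : ∃ r : R, r ≠ 0 ∧
    ∀ 𝔭, algebraMap R K r • (α.1 𝔭 : completedAlgebra K A 𝔭) ∈ completedOrder K Λ 𝔭 := by
  classical
  choose r hr h using fun 𝔭 => hΛ.exists_smul_mem_completedOrder (𝔭 := 𝔭) (α.1 𝔭)
  let T := (finite_setOf_notMem_completedOrderUnits α).toFinset
  refine ⟨∏ 𝔭 ∈ T, r 𝔭, Finset.prod_ne_zero_iff.2 fun 𝔭 _ => hr 𝔭, fun 𝔭 => ?_⟩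
  by_cases h𝔭 : 𝔭 ∈ T
  · rw [← Finset.prod_erase_mul _ _ h𝔭, map_mul, mul_smul]
    exact smul_mem_completedOrder' (HeightOneSpectrum.valuation_le_one _ _) (h 𝔭)
  · have h1 : α.1 𝔭 ∈ completedOrderUnits Λ 𝔭 := by simpa [T] using h𝔭
    exact smul_mem_completedOrder' (HeightOneSpectrum.valuation_le_one _ _)
      (mem_completedOrderUnits.1 h1).1

/-- If `r α` is integral at all primes, multiplication by `r` embeds `Λα` into the noetherian
`R`-module `Λ`. -/
lemma finite_ideleSubmodule (α : ideleGroup D Λ) : Module.Finite R (ideleSubmodule α) := by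
  have := hΛ.finite
  obtain ⟨r, hr, h⟩ := hΛ.exists_smul_idele_mem α
  have hr' : algebraMap R K r ≠ 0 := by simpa using hr
  have hmem : ∀ a ∈ ideleSubmodule α, r • a ∈ Λ := by
    intro a ha
    refine hΛ.mem_of_forall_mem_completedOrder fun 𝔭 => ?_
    obtain ⟨x, hx, hxa⟩ := ha 𝔭
    rw [← algebraMap_smul K r a, TensorProduct.tmul_smul, hxa, ← mul_smul_comm]
    exact mul_mem hx (h 𝔭)
  let f : ideleSubmodule α →ₗ[R] Λ :=
    { toFun := fun a => ⟨r • (a : A), hmem a a.2⟩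
      map_add' := fun a b => Subtype.ext (smul_add _ _ _)
      map_smul' := fun c a => Subtype.ext (smul_comm r c (a : A)) }
  refine Module.Finite.of_injective f fun a b hab => Subtype.ext ?_
  have h1 : r • (a : A) = r • (b : A) := congrArg Subtype.val hab
  rw [← algebraMap_smul K r (a : A), ← algebraMap_smul K r (b : A)] at h1
  exact smul_right_injective _ hr' h1

/-- Approximate `α` at `T` and wherever it is not a local unit. At those primes `y α⁻¹` is a local
unit; at the others both `y` and `α⁻¹` are integral. -/
lemma exists_cycleUnit_mem_ideleSubmodule (α : ideleGroup D Λ)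
    (T : Finset (HeightOneSpectrum R)) : ∃ y ∈ D.cycleUnits, (y : A) ∈ ideleSubmodule α ∧
      ∀ 𝔭 ∈ T, unitsToCompleted K 𝔭 y * (α.1 𝔭)⁻¹ ∈ completedOrderUnits Λ 𝔭 := by
  classical
  let T' := T ∪ (finite_setOf_notMem_completedOrderUnits α).toFinset
  have hT' : ∀ 𝔭 ∉ T', α.1 𝔭 ∈ completedOrderUnits Λ 𝔭 := by
    intro 𝔭 h𝔭
    by_contra h
    exact h𝔭 (Finset.mem_union_right _ (by simpa using h))
  obtain ⟨y, hy, h1, h2⟩ := hΛ.exists_cycleUnit_approx 1 α T' hT'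
  refine ⟨y, hy, mem_ideleSubmodule.2 fun 𝔭 => ?_,
    fun 𝔭 h𝔭 => (h1 𝔭 (Finset.mem_union_left _ h𝔭)).2.1⟩
  by_cases h : 𝔭 ∈ T'
  · exact (mem_completedOrderUnits.1 (h1 𝔭 h).2.1).1
  · exact mul_mem (h2 𝔭 h) (mem_completedOrderUnits.1 (hT' 𝔭 h)).2

lemma exists_smul_mul_inv_mem {α : ideleGroup D Λ} {𝔭 : HeightOneSpectrum R} {y : Aˣ}
    (hy : unitsToCompleted K 𝔭 y * (α.1 𝔭)⁻¹ ∈ completedOrderUnits Λ 𝔭) {a : A}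
    (ha : (1 : 𝔭.adicCompletion K) ⊗ₜ[K] a *
      (((α.1 𝔭)⁻¹ : (completedAlgebra K A 𝔭)ˣ) : completedAlgebra K A 𝔭) ∈
        completedOrder K Λ 𝔭) :
    ∃ s : R, s ∉ 𝔭.asIdeal ∧ s • (a * (y⁻¹ : Aˣ)) ∈ Λ := by
  refine hΛ.exists_smul_mem_of_mem_completedOrder (𝔭 := 𝔭) ?_
  have h1 := mul_mem ha (mem_completedOrderUnits.1 hy).2
  rw [mul_inv_rev, inv_inv, Units.val_mul, mul_assoc, Units.inv_mul_cancel_left, ← map_inv,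
    ← tmul_mul_unitsToCompleted] at h1
  exact h1

/-- Write `s • a` as `(s • (a * y⁻¹)) * y`, where `y ∈ Λα` generates the completion at `𝔭`: local
membership at one prime becomes global after clearing a denominator prime to `𝔭`. -/
lemma exists_smul_mem_ideleSubmodule {α : ideleGroup D Λ} {𝔭 : HeightOneSpectrum R} {a : A}
    (ha : (1 : 𝔭.adicCompletion K) ⊗ₜ[K] a *
      (((α.1 𝔭)⁻¹ : (completedAlgebra K A 𝔭)ˣ) : completedAlgebra K A 𝔭) ∈
        completedOrder K Λ 𝔭) :
    ∃ s : R, s ∉ 𝔭.asIdeal ∧ s • a ∈ ideleSubmodule α := by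
  obtain ⟨y, -, hyα, hy⟩ := hΛ.exists_cycleUnit_mem_ideleSubmodule α {𝔭}
  obtain ⟨s, hs, h⟩ := hΛ.exists_smul_mul_inv_mem (hy 𝔭 (by simp)) ha
  refine ⟨s, hs, ?_⟩
  have h1 := mul_mem_ideleSubmodule h hyα
  rwa [smul_mul_assoc, Units.inv_mul_cancel_right] at h1

/-- The localisation of `Λα` at `p` is free on `y`. Finite generation over `R` gives one `s` for all
`a`, so that `a ↦ s • (a * y⁻¹)` is a map defined on the whole module. -/
lemma exists_local_generator (α : ideleGroup D Λ) (p : PrimeSpectrum R) :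
    ∃ y ∈ D.cycleUnits, (y : A) ∈ ideleSubmodule α ∧ ∃ s ∉ p.asIdeal,
      ∀ a ∈ ideleSubmodule α, s • (a * (y⁻¹ : Aˣ)) ∈ Λ := by
  classical
  have hex : ∃ y ∈ D.cycleUnits, (y : A) ∈ ideleSubmodule α ∧
      ∀ a ∈ ideleSubmodule α, ∃ s ∉ p.asIdeal, s • (a * (y⁻¹ : Aˣ)) ∈ Λ := by
    -- At the zero prime any global unit in `Λα` is a generator, since all nonzero denominators are
    -- allowed.
    by_cases hp : p.asIdeal = ⊥
    · obtain ⟨y, hy, hyα, -⟩ := hΛ.exists_cycleUnit_mem_ideleSubmodule α ∅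
      refine ⟨y, hy, hyα, fun a _ => ?_⟩
      obtain ⟨s, hs, h⟩ := hΛ.exists_smul_mem (a * (y⁻¹ : Aˣ))
      exact ⟨s, by simpa [hp] using hs, h⟩
    · let 𝔭 : HeightOneSpectrum R := ⟨p.asIdeal, p.2, hp⟩
      obtain ⟨y, hy, hyα, h𝔭⟩ := hΛ.exists_cycleUnit_mem_ideleSubmodule α {𝔭}
      exact ⟨y, hy, hyα, fun a ha => hΛ.exists_smul_mul_inv_mem (h𝔭 𝔭 (by simp))
        (mem_ideleSubmodule.1 ha 𝔭)⟩
  obtain ⟨y, hy, hyα, h⟩ := hex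
  refine ⟨y, hy, hyα, ?_⟩
  choose! s hs hsΛ using h
  obtain ⟨T, hT⟩ := (hΛ.finite_ideleSubmodule α).fg_top
  refine ⟨∏ a ∈ T, s a, (Ideal.IsPrime.prod_mem_iff (p := p.asIdeal)).not.2
    (by push Not; exact fun a _ => hs a a.2), fun a ha => ?_⟩
  let f : ideleSubmodule α →ₗ[R] A := (∏ a ∈ T, s a) •
    (LinearMap.mulRight R ((y⁻¹ : Aˣ) : A) ∘ₗ ((ideleSubmodule α).restrictScalars R).subtype)
  have hle : ⊤ ≤ (Subalgebra.toSubmodule Λ).comap f := by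
    rw [← hT, Submodule.span_le]
    intro a ha
    change (∏ a ∈ T, s a) • ((a : A) * (y⁻¹ : Aˣ)) ∈ Λ
    rw [← Finset.prod_erase_mul _ _ ha, mul_smul]
    exact Λ.smul_mem (hsΛ a a.2) _
  exact hle (Submodule.mem_top : (⟨a, ha⟩ : ideleSubmodule α) ∈ ⊤)

end IsDGOrder

/-- Right multiplication by a cycle of degree `0`. -/
def ideleModuleMulRight (α β : ideleGroup D Λ) (x : A) (hx : x ∈ D.zeroCycles)
    (h : ∀ a ∈ ideleSubmodule α, a * x ∈ ideleSubmodule β) :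
    DGMod.Hom (ideleModule hΛ α) (ideleModule hΛ β) where
  toLinearMap := show ideleSubmodule α →ₗ[Λ] ideleSubmodule β from
    { toFun := fun a => ⟨a * x, h a a.2⟩
      map_add' := fun a b => Subtype.ext (add_mul _ _ _)
      map_smul' := fun l a => Subtype.ext (mul_assoc (l : A) _ _) }
  map_gr := fun i (m : ideleSubmodule α) (hm : (m : A) ∈ D.gr i) => by
    have := SetLike.GradedMul.mul_mem (A := D.gr) hm hx.1
    rw [add_zero] at this
    exact this
  map_d := fun (m : ideleSubmodule α) => Subtype.ext (D.d_mul_of_cycle m x hx.2).symm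

include hΛ in
lemma mem_ideleSubmodule_one {a : A} : a ∈ ideleSubmodule (1 : ideleGroup D Λ) ↔ a ∈ Λ := by
  rw [mem_ideleSubmodule]
  have h1 : ∀ 𝔭 : HeightOneSpectrum R, (1 : 𝔭.adicCompletion K) ⊗ₜ[K] a *
      ((((1 : ideleGroup D Λ).1 𝔭)⁻¹ : (completedAlgebra K A 𝔭)ˣ) : completedAlgebra K A 𝔭) =
      (1 : 𝔭.adicCompletion K) ⊗ₜ[K] a := fun 𝔭 => by
    have : (1 : ideleGroup D Λ).1 𝔭 = 1 := rfl
    rw [this, inv_one, Units.val_one, mul_one]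
  simp only [h1]
  exact ⟨hΛ.mem_of_forall_mem_completedOrder, fun h 𝔭 => tmul_mem_completedOrder Λ 𝔭 h⟩

/-- The regular dg-module is the module of the trivial idèle. -/
lemma isomorphic_regular_ideleModule_one :
    DGMod.Isomorphic (DGMod.regular hΛ.toDGAlgebra) (ideleModule hΛ (1 : ideleGroup D Λ)) := by
  let f : Λ →ₗ[Λ] ideleSubmodule (1 : ideleGroup D Λ) :=
    { toFun := fun a => ⟨a, (mem_ideleSubmodule_one hΛ).2 a.2⟩
      map_add' := fun a b => rfl
      map_smul' := fun l a => rfl }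
  refine DGMod.Isomorphic.of_bijective ⟨f, fun i m hm => hm, fun m => rfl⟩ ⟨?_, ?_⟩
  · intro a b hab
    exact Subtype.ext (congrArg (fun x : ideleSubmodule (1 : ideleGroup D Λ) => (x : A)) hab)
  · intro b
    exact ⟨⟨_, (mem_ideleSubmodule_one hΛ).1 b.2⟩, rfl⟩

lemma isomorphic_ideleModule_of_mulRight (α β : ideleGroup D Λ) (x : Aˣ) (hx : x ∈ D.cycleUnits)
    (h : ∀ a, a ∈ ideleSubmodule α ↔ a * x ∈ ideleSubmodule β) :
    DGMod.Isomorphic (ideleModule hΛ α) (ideleModule hΛ β) := by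
  have := hΛ.finiteDimensional
  refine DGMod.Isomorphic.of_bijective (ideleModuleMulRight hΛ α β x
    (DGAlgebra.val_mem_zeroCycles hx) fun a ha => (h a).1 ha) ⟨?_, ?_⟩
  · intro (a : ideleSubmodule α) (b : ideleSubmodule α) hab
    have h1 : (a : A) * x = b * x := congrArg (fun x : ideleSubmodule β => (x : A)) hab
    exact Subtype.ext (x.mul_left_inj.1 h1)
  · intro (b : ideleSubmodule β)
    have hb : (b : A) * (x⁻¹ : Aˣ) * x ∈ ideleSubmodule β := by
      rw [Units.inv_mul_cancel_right]
      exact b.2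
    exact ⟨⟨_, (h _).2 hb⟩, Subtype.ext (Units.inv_mul_cancel_right _ _)⟩

/-- Idèles in the same double coset have isomorphic modules. -/
lemma isomorphic_ideleModule_of_mem_units (α β : ideleGroup D Λ) (x : Aˣ)
    (hx : x ∈ D.cycleUnits)
    (h : ∀ 𝔭, α.1 𝔭 * unitsToCompleted K 𝔭 x * (β.1 𝔭)⁻¹ ∈ completedOrderUnits Λ 𝔭) :
    DGMod.Isomorphic (ideleModule hΛ α) (ideleModule hΛ β) := by
  refine isomorphic_ideleModule_of_mulRight hΛ α β x hx fun a => ?_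
  rw [mem_ideleSubmodule, mem_ideleSubmodule]
  refine forall_congr' fun 𝔭 => ?_
  have h1 := mem_completedOrderUnits.1 (h 𝔭)
  rw [tmul_mul_unitsToCompleted]
  refine ⟨fun h2 => ?_, fun h2 => ?_⟩
  · have h3 := mul_mem h2 h1.1
    simpa only [Units.val_mul, mul_assoc, Units.inv_mul_cancel_left] using h3
  · have h3 := mul_mem h2 h1.2
    simpa only [Units.val_mul, mul_inv_rev, inv_inv, mul_assoc, Units.inv_mul_cancel_left,
      Units.mul_inv_cancel_left, Units.mul_inv_cancel_left, Units.mul_inv, mul_one] using h3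

/-- The modules of idèles are locally free of rank one. -/
lemma isLocallyFreeRankOne_ideleModule (α : ideleGroup D Λ) :
    (ideleModule hΛ α).IsLocallyFreeRankOne := by
  have := hΛ.finiteDimensional
  refine ⟨?_, fun p => ?_⟩
  · have h1 := hΛ.finite_ideleSubmodule α
    have : IsScalarTower R Λ (ideleSubmodule α) := (ideleModule hΛ α).isScalarTower
    have h2 : Module.Finite Λ (ideleSubmodule α) := Module.Finite.of_restrictScalars_finite R Λ _
    exact h2
  · obtain ⟨y, hy, hyα, s, hs, h⟩ := hΛ.exists_local_generator α p
    refine DGMod.Isomorphic.trans ?_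
      ((DGMod.isLocallyFreeRankOne_regular hΛ.toDGAlgebra).2 p)
    refine DGMod.Isomorphic.symm ?_
    have hy0 := DGAlgebra.val_mem_zeroCycles hy
    let f : DGMod.Hom (DGMod.regular hΛ.toDGAlgebra) (ideleModule hΛ α) :=
      { toLinearMap := show Λ →ₗ[Λ] ideleSubmodule α from
          { toFun := fun l => ⟨l * y, mul_mem_ideleSubmodule l.2 hyα⟩
            map_add' := fun a b => Subtype.ext (add_mul _ _ _)
            map_smul' := fun l a => Subtype.ext (mul_assoc (l : A) _ _) }
        map_gr := fun i (m : Λ) (hm : (m : A) ∈ D.gr i) => by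
          have := SetLike.GradedMul.mul_mem (A := D.gr) hm hy0.1
          rw [add_zero] at this
          exact this
        map_d := fun (m : Λ) => Subtype.ext (D.d_mul_of_cycle m y hy0.2).symm }
    let g : ideleSubmodule α →ₗ[R] Λ :=
      { toFun := fun a => ⟨s • ((a : A) * (y⁻¹ : Aˣ)), h a a.2⟩
        map_add' := fun a b => Subtype.ext (by
          simp only [Submodule.coe_add, add_mul, smul_add]; rfl)
        map_smul' := fun c a => Subtype.ext (by
          change s • ((c • (a : A)) * (y⁻¹ : Aˣ)) = c • s • ((a : A) * (y⁻¹ : Aˣ))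
          rw [smul_mul_assoc, smul_comm]) }
    -- Right multiplication by `y` and `a ↦ s • (a * y⁻¹)` are inverse up to `s`, which is
    -- invertible in the localisation at `p`.
    refine DGMod.isomorphic_baseChange_of_comp_eq_smul _ f g s ?_ ?_ ?_
    · exact IsLocalization.map_units (Localization.AtPrime p.asIdeal) (⟨s, hs⟩ : p.asIdeal.primeCompl)
    · intro (m : Λ)
      refine Subtype.ext ?_
      change s • ((m : A) * y * (y⁻¹ : Aˣ)) = s • (m : A)
      rw [Units.mul_inv_cancel_right]
    · intro (a : ideleSubmodule α)
      refine Subtype.ext ?_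
      change s • ((a : A) * (y⁻¹ : Aˣ)) * y = s • (a : A)
      rw [smul_mul_assoc, Units.inv_mul_cancel_right]

/-- The principal idèle of a homogeneous unit in the kernel of the differential. -/
noncomputable def principalIdele (x : Aˣ) (hx : x ∈ D.cycleUnits) : ideleGroup D Λ :=
  ⟨fun 𝔭 => unitsToCompleted K 𝔭 x, fun 𝔭 => by
    have := hΛ.finiteDimensional
    refine DGAlgebra.mem_cycleUnits_of_mem_zeroCycles ⟨?_, ?_⟩
    · exact Submodule.tmul_mem_baseChange_of_mem _ (DGAlgebra.val_mem_zeroCycles hx).1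
    · change D.d.baseChange _ (1 ⊗ₜ (x : A)) = 0
      rw [LinearMap.baseChange_tmul, hx.2, TensorProduct.tmul_zero], by
    obtain ⟨s, hs, h⟩ := hΛ.exists_smul_mem x
    obtain ⟨t, ht, h'⟩ := hΛ.exists_smul_mem ((x⁻¹ : Aˣ) : A)
    have hfin := HeightOneSpectrum.finite_setOf_mem (mul_ne_zero hs ht)
    refine hfin.subset fun 𝔭 h𝔭 => ?_
    by_contra hst
    have hst' : s * t ∉ 𝔭.asIdeal := hst
    refine h𝔭 (mem_completedOrderUnits.2 ⟨tmul_mem_completedOrder_of_smul_mem (fun h => hst' ?_) h, ?_⟩)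
    · exact Ideal.mul_mem_right _ _ h
    · rw [← map_inv]
      exact tmul_mem_completedOrder_of_smul_mem (fun h => hst' (Ideal.mul_mem_left _ _ h)) h'⟩

lemma isomorphic_ideleModule_mul_principalIdele (α : ideleGroup D Λ) (x : Aˣ)
    (hx : x ∈ D.cycleUnits) :
    DGMod.Isomorphic (ideleModule hΛ α) (ideleModule hΛ (α * principalIdele hΛ x hx)) := by
  refine isomorphic_ideleModule_of_mem_units hΛ _ _ x hx fun 𝔭 => ?_
  have : (α * principalIdele hΛ x hx).1 𝔭 = α.1 𝔭 * unitsToCompleted K 𝔭 x := rfl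
  rw [this, mul_inv_cancel]
  exact one_mem _

/-! ### The exact sequence and additivity of idèle classes -/

/-- A criterion for a Mayer–Vietoris sequence of modules of idèles. -/
lemma hasShortExact_ideleModule (α β : ideleGroup D Λ)
    (hα : ∀ 𝔭, (α.1 𝔭 : completedAlgebra K A 𝔭) ∈ completedOrder K Λ 𝔭)
    (hβ : ∀ 𝔭, (β.1 𝔭 : completedAlgebra K A 𝔭) ∈ completedOrder K Λ 𝔭)
    (hαβ : ∀ 𝔭, α.1 𝔭 ∈ completedOrderUnits Λ 𝔭 ∨ (β.1 𝔭 ∈ completedOrderUnits Λ 𝔭 ∧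
      α.1 𝔭 * β.1 𝔭 * (α.1 𝔭)⁻¹ ∈ completedOrderUnits Λ 𝔭)) :
    DGMod.HasShortExact (ideleModule hΛ (α * β))
      (DGMod.prod (ideleModule hΛ α) (ideleModule hΛ β)) (ideleModule hΛ 1) := by
  have hmul : ∀ 𝔭, (α * β).1 𝔭 = α.1 𝔭 * β.1 𝔭 := fun _ => rfl
  -- `a α⁻¹ = a (αβ)⁻¹ · αβα⁻¹`, so what is needed is integrality of the conjugate of `β`, not of
  -- `β` itself.
  have h1 : ∀ a ∈ ideleSubmodule (α * β), a ∈ ideleSubmodule α := by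
    intro a ha
    rw [mem_ideleSubmodule] at ha ⊢
    intro 𝔭
    have h2 : ((α.1 𝔭 * β.1 𝔭 * (α.1 𝔭)⁻¹ : (completedAlgebra K A 𝔭)ˣ) :
        completedAlgebra K A 𝔭) ∈ completedOrder K Λ 𝔭 := by
      rcases hαβ 𝔭 with h | h
      · exact mul_mem (mul_mem (hα 𝔭) (hβ 𝔭)) (mem_completedOrderUnits.1 h).2
      · exact (mem_completedOrderUnits.1 h.2).1
    have h3 := mul_mem (ha 𝔭) h2
    rwa [hmul, mul_assoc, ← Units.val_mul, ← mul_assoc, inv_mul_cancel, one_mul] at h3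
  have h2 : ∀ a ∈ ideleSubmodule (α * β), a ∈ ideleSubmodule β := by
    intro a ha
    rw [mem_ideleSubmodule] at ha ⊢
    intro 𝔭
    have h3 := mul_mem (ha 𝔭) (hα 𝔭)
    rwa [hmul, mul_assoc, ← Units.val_mul, mul_inv_rev, inv_mul_cancel_right] at h3
  have h3 : ∀ a ∈ ideleSubmodule α, a ∈ ideleSubmodule β → a ∈ ideleSubmodule (α * β) := by
    intro a ha hb
    rw [mem_ideleSubmodule] at ha hb ⊢
    intro 𝔭
    rcases hαβ 𝔭 with h | h
    · have h4 := mul_mem (hb 𝔭) (mem_completedOrderUnits.1 h).2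
      rwa [mul_assoc, ← Units.val_mul, ← mul_inv_rev] at h4
    · have h4 := mul_mem (ha 𝔭) (mem_completedOrderUnits.1 h.2).2
      rw [mul_assoc, ← Units.val_mul] at h4
      rw [hmul]
      convert h4 using 3
      group
  have hle : ∀ γ : ideleGroup D Λ,
      (∀ 𝔭, (γ.1 𝔭 : completedAlgebra K A 𝔭) ∈ completedOrder K Λ 𝔭) →
      ∀ a ∈ ideleSubmodule γ, a ∈ ideleSubmodule (1 : ideleGroup D Λ) := by
    intro γ hγ a ha
    rw [mem_ideleSubmodule_one hΛ]
    refine hΛ.mem_of_forall_mem_completedOrder fun 𝔭 => ?_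
    obtain ⟨x, hx, h⟩ := ha 𝔭
    rw [h]
    exact mul_mem hx (hγ 𝔭)
  -- Comaximality is local: at each prime one of `α`, `β` is a unit, so a multiple of 1 by a scalar
  -- prime to `𝔭` lies in the corresponding summand.
  have h4 : ∃ a ∈ ideleSubmodule α, ∃ b ∈ ideleSubmodule β, a + b = 1 := by
    let N : Submodule R A :=
      (ideleSubmodule α).restrictScalars R ⊔ (ideleSubmodule β).restrictScalars R
    let I : Ideal R := N.comap (LinearMap.toSpanSingleton R A 1)
    have hI : ∀ s, s ∈ I ↔ s • (1 : A) ∈ N := fun s => Iff.rfl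
    have hsub : ∀ γ : ideleGroup D Λ, (ideleSubmodule γ).restrictScalars R ≤ N →
        ∀ 𝔭, γ.1 𝔭 ∈ completedOrderUnits Λ 𝔭 → ∃ s ∈ I, s ∉ 𝔭.asIdeal := by
      intro γ hγ 𝔭 h
      obtain ⟨s, hs, h1⟩ := hΛ.exists_smul_mem_ideleSubmodule (α := γ) (𝔭 := 𝔭) (a := 1) (by
        rw [← Algebra.TensorProduct.one_def, one_mul]
        exact (mem_completedOrderUnits.1 h).2)
      exact ⟨s, hγ h1, hs⟩
    have htop : I = ⊤ := by
      refine Ideal.eq_top_of_forall_not_le ?_ fun 𝔭 => ?_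
      · obtain ⟨y, -, hy, s, hs, h⟩ := hΛ.exists_local_generator α ⟨⊥, Ideal.isPrime_bot⟩
        obtain ⟨t, ht, h'⟩ := hΛ.exists_smul_mem ((y⁻¹ : Aˣ) : A)
        have h5 := mul_mem_ideleSubmodule h' hy
        rw [smul_mul_assoc, Units.inv_mul] at h5
        have h6 : t ∈ I := (le_sup_left : _ ≤ N) h5
        rintro h0
        rw [h0, Ideal.mem_bot] at h6
        exact ht h6
      · rcases hαβ 𝔭 with h | h
        · exact hsub α le_sup_left 𝔭 h
        · exact hsub β le_sup_right 𝔭 h.1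
    have h1N : (1 : A) ∈ N := by
      have := (hI 1).1 (htop ▸ Submodule.mem_top)
      rwa [one_smul] at this
    exact Submodule.mem_sup.1 h1N |>.imp fun a h => ⟨h.1, h.2⟩
  have hone : (1 : A) ∈ D.zeroCycles := ⟨SetLike.GradedOne.one_mem, D.d_one⟩
  let f1 := ideleModuleMulRight hΛ (α * β) α 1 hone fun a ha => by rw [mul_one]; exact h1 a ha
  let f2 := ideleModuleMulRight hΛ (α * β) β 1 hone fun a ha => by rw [mul_one]; exact h2 a ha
  let g1 := ideleModuleMulRight hΛ α 1 1 hone fun a ha => by rw [mul_one]; exact hle α hα a ha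
  let g2 := ideleModuleMulRight hΛ β 1 (-1) (neg_mem hone) fun a ha => by
    rw [mul_neg, mul_one]; exact neg_mem (hle β hβ a ha)
  refine ⟨f1.prod f2, g1.coprod g2, ?_, ?_, ?_⟩
  · intro (a : ideleSubmodule (α * β)) (b : ideleSubmodule (α * β)) hab
    have h5 : (a : A) * 1 = b * 1 :=
      congrArg (fun x : ideleSubmodule α × ideleSubmodule β => (x.1 : A)) hab
    rw [mul_one, mul_one] at h5
    exact Subtype.ext h5
  · rintro ⟨(a : ideleSubmodule α), (b : ideleSubmodule β)⟩
    constructor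
    · intro h
      have h5 : (a : A) * 1 + b * (-1) = 0 :=
        congrArg (fun x : ideleSubmodule (1 : ideleGroup D Λ) => (x : A)) h
      rw [mul_one, mul_neg, mul_one, ← sub_eq_add_neg, sub_eq_zero] at h5
      refine ⟨(⟨a, h3 a a.2 (h5 ▸ b.2)⟩ : ideleSubmodule (α * β)), Prod.ext ?_ ?_⟩
      · exact Subtype.ext (mul_one (a : A))
      · exact Subtype.ext ((mul_one (a : A)).trans h5)
    · rintro ⟨(c : ideleSubmodule (α * β)), hc⟩
      have ha : (c : A) * 1 = a :=
        congrArg (fun x : ideleSubmodule α × ideleSubmodule β => (x.1 : A)) hc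
      have hb : (c : A) * 1 = b :=
        congrArg (fun x : ideleSubmodule α × ideleSubmodule β => (x.2 : A)) hc
      refine Subtype.ext ?_
      change (a : A) * 1 + b * (-1) = 0
      rw [← ha, ← hb]
      simp
  · intro (l : ideleSubmodule (1 : ideleGroup D Λ))
    obtain ⟨a, ha, b, hb, hab⟩ := h4
    have hl := (mem_ideleSubmodule_one hΛ).1 l.2
    refine ⟨((⟨l * a, mul_mem_ideleSubmodule hl ha⟩ : ideleSubmodule α),
      (⟨-(l * b), neg_mem (mul_mem_ideleSubmodule hl hb)⟩ : ideleSubmodule β)), Subtype.ext ?_⟩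
    change (l : A) * a * 1 + -((l : A) * b) * (-1) = l
    rw [mul_one, neg_mul_neg, mul_one, ← mul_add, hab, mul_one]

/-- The class of an idèle in the Grothendieck group. -/
noncomputable def ideleCls (α : ideleGroup D Λ) : G0 hΛ.toDGAlgebra :=
  G0.cls (ideleModule hΛ α) (isLocallyFreeRankOne_ideleModule hΛ α).isLF0

lemma ideleCls_eq_of_isomorphic {α β : ideleGroup D Λ}
    (h : DGMod.Isomorphic (ideleModule hΛ α) (ideleModule hΛ β)) :
    ideleCls hΛ α = ideleCls hΛ β :=
  G0.cls_eq_of_isomorphic _ _ h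

lemma ideleCls_one : ideleCls hΛ (1 : ideleGroup D Λ) = G0.regularCls hΛ.toDGAlgebra :=
  (G0.cls_eq_of_isomorphic _ _ (isomorphic_regular_ideleModule_one hΛ)).symm

lemma ideleCls_mul_principalIdele (α : ideleGroup D Λ) (x : Aˣ) (hx : x ∈ D.cycleUnits) :
    ideleCls hΛ (α * principalIdele hΛ x hx) = ideleCls hΛ α :=
  (ideleCls_eq_of_isomorphic hΛ (isomorphic_ideleModule_mul_principalIdele hΛ α x hx)).symm

/-- Choose `x` close to `β⁻¹` at the primes where `α` or `β` is not a local unit. There `βx` and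
`αβxα⁻¹` become local units; elsewhere `α` is one and `βx` is integral, so the exact sequence
applies. Passing from `β` to `βx` changes no class. -/
lemma ideleCls_add_of_integral (α β : ideleGroup D Λ)
    (hα : ∀ 𝔭, (α.1 𝔭 : completedAlgebra K A 𝔭) ∈ completedOrder K Λ 𝔭) :
    ideleCls hΛ α + ideleCls hΛ β = ideleCls hΛ (α * β) + ideleCls hΛ 1 := by
  classical
  let T := (finite_setOf_notMem_completedOrderUnits α).toFinset ∪
    (finite_setOf_notMem_completedOrderUnits β).toFinset
  have hT : ∀ 𝔭 ∉ T, α.1 𝔭 ∈ completedOrderUnits Λ 𝔭 ∧ β.1 𝔭 ∈ completedOrderUnits Λ 𝔭 := by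
    intro 𝔭 h𝔭
    simpa [T] using h𝔭
  obtain ⟨x, hx, h1, h2⟩ := hΛ.exists_cycleUnit_approx α β⁻¹ T fun 𝔭 h𝔭 => inv_mem (hT 𝔭 h𝔭).2
  have hinv : ∀ 𝔭, ((β⁻¹ : ideleGroup D Λ).1 𝔭)⁻¹ = β.1 𝔭 := fun 𝔭 => inv_inv _
  let β' := β * principalIdele hΛ x hx
  have hβ' : ∀ 𝔭, β'.1 𝔭 = β.1 𝔭 * unitsToCompleted K 𝔭 x := fun _ => rfl
  have h3 := G0.cls_add_cls_eq_of_hasShortExact_prod (isLocallyFreeRankOne_ideleModule hΛ α)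
    (isLocallyFreeRankOne_ideleModule hΛ β')
    (isLocallyFreeRankOne_ideleModule hΛ (α * β')).isLF0
    (isLocallyFreeRankOne_ideleModule hΛ 1).isLF0
    (hasShortExact_ideleModule hΛ α β' hα (fun 𝔭 => ?_) fun 𝔭 => ?_)
  · change ideleCls hΛ α + ideleCls hΛ β' = ideleCls hΛ (α * β') + ideleCls hΛ 1 at h3
    rwa [← mul_assoc, ideleCls_mul_principalIdele, ideleCls_mul_principalIdele] at h3
  · rw [hβ']
    by_cases h : 𝔭 ∈ T
    · have := (h1 𝔭 h).1
      rw [hinv] at this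
      exact (mem_completedOrderUnits.1 this).1
    · exact mul_mem (mem_completedOrderUnits.1 (hT 𝔭 h).2).1 (h2 𝔭 h)
  · by_cases h : 𝔭 ∈ T
    · have := h1 𝔭 h
      rw [hinv] at this
      refine Or.inr ⟨this.1, ?_⟩
      rw [hβ', ← mul_assoc]
      exact this.2.2
    · exact Or.inl (hT 𝔭 h).1

lemma ideleCls_add (α β : ideleGroup D Λ) :
    ideleCls hΛ α + ideleCls hΛ β = ideleCls hΛ (α * β) + ideleCls hΛ 1 := by
  obtain ⟨r, hr, h⟩ := hΛ.exists_smul_idele_mem α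
  have hr' : algebraMap R K r ≠ 0 := by simpa using hr
  -- Multiplication by the scalar `r` makes `α` integral. As `ρ` is central it can be moved past `β`
  -- in `αρβ` and then dropped as a principal factor on the right.
  let ρ : Aˣ := Units.map (algebraMap K A).toMonoidHom (Units.mk0 _ hr')
  have hρ : ρ ∈ D.cycleUnits := by
    refine DGAlgebra.mem_cycleUnits_of_mem_zeroCycles ⟨?_, ?_⟩
    · exact SetLike.algebraMap_mem_graded D.gr _
    · change D.d (algebraMap K A _) = 0
      rw [Algebra.algebraMap_eq_smul_one, map_smul, D.d_one, smul_zero]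
  have hρ' : ∀ 𝔭 : HeightOneSpectrum R, (unitsToCompleted K 𝔭 ρ : completedAlgebra K A 𝔭) =
      algebraMap K _ (algebraMap R K r) := fun 𝔭 =>
    (Algebra.TensorProduct.includeRight : A →ₐ[K] completedAlgebra K A 𝔭).commutes _
  have hcomm : ∀ γ : ideleGroup D Λ,
      principalIdele hΛ ρ hρ * γ = γ * principalIdele hΛ ρ hρ := by
    intro γ
    refine Subtype.ext (funext fun 𝔭 => Units.ext ?_)
    change (unitsToCompleted K 𝔭 ρ : completedAlgebra K A 𝔭) * γ.1 𝔭 =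
      γ.1 𝔭 * (unitsToCompleted K 𝔭 ρ : completedAlgebra K A 𝔭)
    rw [hρ']
    exact Algebra.commutes _ _
  have h1 := ideleCls_add_of_integral hΛ (α * principalIdele hΛ ρ hρ) β fun 𝔭 => by
    change (α.1 𝔭 : completedAlgebra K A 𝔭) * (unitsToCompleted K 𝔭 ρ : completedAlgebra K A 𝔭) ∈ _
    rw [hρ', ← Algebra.commutes, ← Algebra.smul_def]
    exact h 𝔭
  rwa [mul_assoc, hcomm, ← mul_assoc, ideleCls_mul_principalIdele,
    ideleCls_mul_principalIdele] at h1

end Ideles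

/-! ### Lattices as idèle modules, and the map to the class group -/

lemma mk_one_injective_of_isTorsionFree {R M : Type*} [CommRing R] [IsDomain R] [AddCommGroup M]
    [Module R M] [Module.IsTorsionFree R M] (p : Ideal R) [p.IsPrime] :
    Function.Injective (TensorProduct.mk R (Localization.AtPrime p) M 1) := by
  intro x y hxy
  obtain ⟨c, hc⟩ := (IsLocalizedModule.eq_iff_exists p.primeCompl
    (TensorProduct.mk R (Localization.AtPrime p) M 1)).1 hxy
  have hc0 : (c : R) ≠ 0 := fun h => c.2 (h ▸ p.zero_mem)
  exact smul_right_injective M hc0 hc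

section ClassGroup

variable {R : Type u} {K : Type v} {A : Type w} [CommRing R] [Field K] [Algebra R K]
  [Ring A] [Algebra K A] [Algebra R A] [IsScalarTower R K A]
  [IsDedekindDomain R] [IsFractionRing R K]
  {D : DGAlgebra K A} {Λ : Subalgebra R A} (hΛ : IsDGOrder D Λ)

/-- An embedding of a dg-module into a dg-order which is locally given by right multiplication
with global units comes from an idèle. -/
lemma exists_isomorphic_ideleModule_of_hom {L : DGMod hΛ.toDGAlgebra}
    (f : DGMod.Hom L (DGMod.regular hΛ.toDGAlgebra)) (hf : Function.Injective f.toLinearMap)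
    {s₀ : R} (hs₀ : s₀ ≠ 0) (hs₀f : ∀ l : Λ, ∃ m, f.toLinearMap m = s₀ • l)
    (hloc : ∀ 𝔭 : HeightOneSpectrum R, ∃ y ∈ D.cycleUnits,
      (∃ m, ((show Λ from f.toLinearMap m) : A) = (y : Aˣ)) ∧ ∃ s ∉ 𝔭.asIdeal, ∀ m,
        s • (((show Λ from f.toLinearMap m) : A) * (y⁻¹ : Aˣ)) ∈ Λ) :
    ∃ α : ideleGroup D Λ, DGMod.Isomorphic L (ideleModule hΛ α) := by
  classical
  choose y hy hm hs' using hloc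
  choose m₀ hm₀ using hm
  choose s hs hsΛ using hs'
  let j : L.carrier →ₗ[Λ] Λ := f.toLinearMap
  let φ : L.carrier → A := fun m => j m
  have φ_smul : ∀ (r : R) m, φ (r • m) = r • φ m := fun r m =>
    congrArg (fun x : Λ => (x : A)) (j.map_smul_of_tower r m)
  have φ_mul : ∀ (l : Λ) m, φ (l • m) = l * φ m := fun l m =>
    congrArg (fun x : Λ => (x : A)) (j.map_smul l m)
  have hφs : ∀ l ∈ Λ, ∃ m, φ m = s₀ • l := fun l hl => by
    obtain ⟨m, hm⟩ := hs₀f ⟨l, hl⟩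
    exact ⟨m, congrArg (fun x : Λ => (x : A)) hm⟩
  -- The image of `f` contains `s₀ Λ`, so it equals `Λ` locally at primes not dividing `s₀`, and the
  -- component 1 is right there. Only finitely many components differ from 1.
  let α : ideleGroup D Λ :=
    ⟨fun 𝔭 => if s₀ ∈ 𝔭.asIdeal then unitsToCompleted K 𝔭 (y 𝔭) else 1, fun 𝔭 => by
      dsimp only
      split_ifs
      · exact (principalIdele hΛ (y 𝔭) (hy 𝔭)).2.1 𝔭
      · exact one_mem _, by
      refine (HeightOneSpectrum.finite_setOf_mem hs₀).subset fun 𝔭 h𝔭 => ?_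
      by_contra h
      refine h𝔭 ?_
      have h' : s₀ ∉ 𝔭.asIdeal := h
      change (if s₀ ∈ 𝔭.asIdeal then unitsToCompleted K 𝔭 (y 𝔭) else 1) ∈ completedOrderUnits Λ 𝔭
      rw [if_neg h']
      exact one_mem _⟩
  have hα : ∀ 𝔭, s₀ ∈ 𝔭.asIdeal → α.1 𝔭 = unitsToCompleted K 𝔭 (y 𝔭) := fun 𝔭 h => if_pos h
  have hα' : ∀ 𝔭, s₀ ∉ 𝔭.asIdeal → α.1 𝔭 = 1 := fun 𝔭 h => if_neg h
  have h1 : ∀ m, φ m ∈ ideleSubmodule α := by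
    intro m
    rw [mem_ideleSubmodule]
    intro 𝔭
    by_cases h : s₀ ∈ 𝔭.asIdeal
    · rw [hα 𝔭 h, ← map_inv, ← tmul_mul_unitsToCompleted]
      exact tmul_mem_completedOrder_of_smul_mem (hs 𝔭) (hsΛ 𝔭 m)
    · rw [hα' 𝔭 h, inv_one, Units.val_one, mul_one]
      exact tmul_mem_completedOrder Λ 𝔭 (j m).2
  have h2 : ∀ a ∈ ideleSubmodule α, ∃ m, φ m = a := by
    intro a ha
    rw [mem_ideleSubmodule] at ha
    let φ' : L.carrier →ₗ[R] A := ⟨⟨φ, fun m m' =>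
      congrArg (fun x : Λ => (x : A)) (j.map_add m m')⟩, φ_smul⟩
    let I : Ideal R := (LinearMap.range φ').comap (LinearMap.toSpanSingleton R A a)
    have hI : ∀ r, r ∈ I ↔ ∃ m, φ m = r • a := fun r => Iff.rfl
    have htop : I = ⊤ := by
      refine Ideal.eq_top_of_forall_not_le ?_ fun 𝔭 => ?_
      · obtain ⟨t, ht, h⟩ := hΛ.exists_smul_mem a
        obtain ⟨m, hm⟩ := hφs _ h
        have h3 : s₀ * t ∈ I := (hI _).2 ⟨m, by rw [hm, mul_smul]⟩
        intro h0
        rw [h0, Ideal.mem_bot] at h3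
        exact mul_ne_zero hs₀ ht h3
      · have h3 := ha 𝔭
        by_cases h : s₀ ∈ 𝔭.asIdeal
        · rw [hα 𝔭 h, ← map_inv, ← tmul_mul_unitsToCompleted] at h3
          obtain ⟨t, ht, h4⟩ := hΛ.exists_smul_mem_of_mem_completedOrder h3
          refine ⟨t, (hI t).2 ⟨(⟨_, h4⟩ : Λ) • m₀ 𝔭, ?_⟩, ht⟩
          have h5 : φ (m₀ 𝔭) = y 𝔭 := hm₀ 𝔭
          rw [φ_mul, h5]
          change t • (a * ((y 𝔭)⁻¹ : Aˣ)) * (y 𝔭 : A) = _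
          rw [smul_mul_assoc, Units.inv_mul_cancel_right]
        · rw [hα' 𝔭 h, inv_one, Units.val_one, mul_one] at h3
          obtain ⟨t, ht, h4⟩ := hΛ.exists_smul_mem_of_mem_completedOrder h3
          obtain ⟨m, hm⟩ := hφs _ h4
          refine ⟨s₀ * t, (hI _).2 ⟨m, by rw [hm, mul_smul]⟩, fun h5 => ?_⟩
          exact (𝔭.isPrime.mem_or_mem h5).elim h ht
    obtain ⟨m, hm⟩ := (hI 1).1 (htop ▸ Submodule.mem_top)
    exact ⟨m, by rw [hm, one_smul]⟩
  let F : L.carrier →ₗ[Λ] ideleSubmodule α :=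
    { toFun := fun m => ⟨φ m, h1 m⟩
      map_add' := fun m m' => Subtype.ext (congrArg (fun x : Λ => (x : A)) (j.map_add m m'))
      map_smul' := fun l m => Subtype.ext (φ_mul l m) }
  refine ⟨α, DGMod.Isomorphic.of_bijective ⟨F, fun i m hm => f.map_gr i m hm, fun m =>
    Subtype.ext (congrArg (fun x : Λ => (x : A)) (f.map_d m))⟩ ⟨fun m m' h => hf ?_, fun a => ?_⟩⟩
  · exact Subtype.ext (congrArg (fun x : ideleSubmodule α => (x : A)) h)
  · obtain ⟨m, hm⟩ := h2 _ (show ideleSubmodule α from a).2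
    exact ⟨m, Subtype.ext hm⟩

/-- Every locally free dg-lattice of rank one comes from an idèle. -/
lemma exists_isomorphic_ideleModule {L : DGMod hΛ.toDGAlgebra} (hL : L.IsLocallyFreeRankOne)
    (hproj : Module.Projective R L.carrier) :
    ∃ α : ideleGroup D Λ, DGMod.Isomorphic L (ideleModule hΛ α) := by
  have := hΛ.projective
  have := hΛ.isArtinianRing
  have hfin : Module.Finite Λ L.carrier := hL.1
  have hfin' : Module.Finite Λ (DGMod.regular hΛ.toDGAlgebra).carrier :=
    (inferInstance : Module.Finite Λ Λ)
  have hproj' : Module.Projective R (DGMod.regular hΛ.toDGAlgebra).carrier := hΛ.projective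
  have hquasi : ∀ p : PrimeSpectrum R, ∃ (f : DGMod.Hom L (DGMod.regular hΛ.toDGAlgebra))
      (g : DGMod.Hom (DGMod.regular hΛ.toDGAlgebra) L) (s : R), s ∉ p.asIdeal ∧
      (∀ m, g.toLinearMap (f.toLinearMap m) = s • m) ∧
      ∀ n, f.toLinearMap (g.toLinearMap n) = s • n := fun p =>
    DGMod.exists_comp_eq_smul_of_isomorphic p.asIdeal
      (mk_one_injective_of_isTorsionFree p.asIdeal)
      (mk_one_injective_of_isTorsionFree p.asIdeal)
      ((hL.2 p).trans ((DGMod.isLocallyFreeRankOne_regular hΛ.toDGAlgebra).2 p).symm)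
  -- The generic pair fixes one embedding `f₀` of `L` into `Λ`, with image containing `s₀ Λ`; the
  -- other primes are compared with it.
  obtain ⟨f₀, g₀, s₀, hs₀, hgf₀, hfg₀⟩ := hquasi ⟨⊥, Ideal.isPrime_bot⟩
  replace hs₀ : s₀ ≠ 0 := by simpa using hs₀
  refine exists_isomorphic_ideleModule_of_hom hΛ f₀ (fun m m' h => ?_) hs₀
    (fun l => ⟨g₀.toLinearMap l, hfg₀ l⟩) fun 𝔭 => ?_
  · have h1 := congrArg g₀.toLinearMap h
    rw [hgf₀, hgf₀] at h1
    exact smul_right_injective _ hs₀ h1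
  · obtain ⟨f, g, s, hs, hgf, hfg⟩ := hquasi ⟨𝔭.asIdeal, 𝔭.isPrime⟩
    let j₀ : L.carrier →ₗ[Λ] Λ := f₀.toLinearMap
    let j : L.carrier →ₗ[Λ] Λ := f.toLinearMap
    let γ : Λ →ₗ[Λ] L.carrier := g.toLinearMap
    -- The composite of `g : Λ → L` with `f₀` is right multiplication by `y`, a degree-0 cycle
    -- because both maps are dg homomorphisms. As `g` is an isomorphism at `𝔭`, `y` generates the
    -- image of `f₀` there.
    let y : Λ := j₀ (γ 1)
    have hy0 : (y : A) ∈ D.gr 0 :=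
      f₀.map_gr 0 _ (g.map_gr 0 (1 : Λ) (SetLike.GradedOne.one_mem (A := D.gr)))
    have hyd : D.d (y : A) = 0 := by
      have h1 := f₀.map_d (γ 1)
      have h2 := g.map_d (1 : Λ)
      have h3 : (DGMod.regular hΛ.toDGAlgebra).d (1 : Λ) = (0 : Λ) := hΛ.toDGAlgebra.d_one
      rw [h3] at h2
      have h4 : L.d (γ 1) = 0 := h2.symm.trans (map_zero γ)
      rw [h4] at h1
      exact congrArg (fun x : Λ => (x : A)) (h1.symm.trans (map_zero j₀))
    have hmul : ∀ m, s • (j₀ m : A) = j m * y := by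
      intro m
      have h1 : γ (j m) = s • m := hgf m
      have h2 : γ (j m) = j m • γ 1 := by rw [← map_smul, smul_eq_mul, mul_one]
      have h3 := congrArg j₀ (h1.symm.trans h2)
      rw [j₀.map_smul, j₀.map_smul_of_tower s m] at h3
      exact congrArg (fun x : Λ => (x : A)) h3
    -- At `m = g₀ 1` the relation `hmul` expresses the nonzero scalar `s * s₀` as a left multiple of
    -- `y`, so `y` has a left inverse in the artinian ring `A`.
    have hunit : IsUnit (y : A) := by
      have h1 : j₀ (g₀.toLinearMap (1 : Λ)) = s₀ • (1 : Λ) := hfg₀ (1 : Λ)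
      have h2 := hmul (g₀.toLinearMap (1 : Λ))
      rw [h1] at h2
      have hs' : algebraMap R K (s * s₀) ≠ 0 := by
        have : s ≠ 0 := fun h => hs (h ▸ 𝔭.asIdeal.zero_mem)
        simp [this, hs₀]
      have h3 : ((algebraMap R K (s * s₀))⁻¹ • (j (g₀.toLinearMap (1 : Λ)) : A)) * y = 1 := by
        rw [smul_mul_assoc, ← h2]
        change _ • s • s₀ • (1 : A) = 1
        rw [smul_smul s s₀, ← algebraMap_smul K (s * s₀) (1 : A), inv_smul_smul₀ hs']
      exact IsUnit.of_mul_eq_one_right _ h3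
    obtain ⟨u, hu⟩ := hunit
    refine ⟨u, DGAlgebra.mem_cycleUnits_of_mem_zeroCycles (by rw [hu]; exact ⟨hy0, hyd⟩),
      ⟨γ 1, hu.symm⟩, s, hs, fun m => ?_⟩
    change s • ((j₀ m : A) * (u⁻¹ : Aˣ)) ∈ Λ
    rw [← smul_mul_assoc, hmul, ← hu, Units.mul_inv_cancel_right]
    exact (j m).2

/-- Inside the `K`-space `A` the module is torsion-free, hence flat over the Dedekind domain `R`;
being finitely presented, it is projective. -/
lemma projective_ideleModule (α : ideleGroup D Λ) :
    Module.Projective R (ideleModule hΛ α).carrier := by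
  have h1 := hΛ.finite_ideleSubmodule α
  have h2 : Module.IsTorsionFree R (ideleSubmodule α) := by
    refine .of_smul_eq_zero fun r a h => ?_
    have h3 : r • (a : A) = 0 := congrArg (fun x : ideleSubmodule α => (x : A)) h
    rw [← algebraMap_smul K r (a : A), smul_eq_zero] at h3
    exact h3.imp (fun h => by simpa using h) Subtype.ext
  have h3 : Module.FinitePresentation R (ideleSubmodule α) :=
    Module.finitePresentation_of_finite R _
  have h4 : Module.Projective R (ideleSubmodule α) :=
    Module.Flat.projective_of_finitePresentation
  exact h4

lemma ideleCls_sub_mem (α : ideleGroup D Λ) :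
    ideleCls hΛ α - G0.regularCls hΛ.toDGAlgebra ∈ DGClassGroup hΛ.toDGAlgebra :=
  AddSubgroup.subset_closure ⟨_, isLocallyFreeRankOne_ideleModule hΛ α,
    projective_ideleModule hΛ α, rfl⟩

lemma ideleCls_add_sub (α β : ideleGroup D Λ) :
    ideleCls hΛ (α * β) - G0.regularCls hΛ.toDGAlgebra =
      (ideleCls hΛ α - G0.regularCls hΛ.toDGAlgebra) +
        (ideleCls hΛ β - G0.regularCls hΛ.toDGAlgebra) := by
  rw [sub_add_sub_comm, ideleCls_add, ideleCls_one]
  abel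

/-- The homomorphism `α ↦ [Λα] - [Λ]` from idèles to the class group. -/
noncomputable def ideleToClassGroup :
    ideleGroup D Λ →* Multiplicative (DGClassGroup hΛ.toDGAlgebra) where
  toFun α := Multiplicative.ofAdd ⟨_, ideleCls_sub_mem hΛ α⟩
  map_one' := by
    rw [← ofAdd_zero]
    refine congrArg _ (Subtype.ext ?_)
    change ideleCls hΛ 1 - _ = 0
    rw [ideleCls_one, sub_self]
  map_mul' α β := by
    rw [← ofAdd_add]
    exact congrArg _ (Subtype.ext (ideleCls_add_sub hΛ α β))

lemma coe_ideleToClassGroup (α : ideleGroup D Λ) :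
    ((ideleToClassGroup hΛ α).toAdd : G0 hΛ.toDGAlgebra) =
      ideleCls hΛ α - G0.regularCls hΛ.toDGAlgebra := rfl

/-- The generators of the class group are hit because every lattice of the required kind is some
`Λα`; the homomorphism property then covers sums and negatives. -/
lemma ideleToClassGroup_surjective : Function.Surjective (ideleToClassGroup hΛ) := by
  have key : ∀ x ∈ DGClassGroup hΛ.toDGAlgebra, ∃ α : ideleGroup D Λ,
      ((ideleToClassGroup hΛ α).toAdd : G0 hΛ.toDGAlgebra) = x := by
    intro x hx
    induction hx using AddSubgroup.closure_induction with
    | mem x hx =>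
      obtain ⟨L, hL, hproj, rfl⟩ := hx
      obtain ⟨α, hα⟩ := exists_isomorphic_ideleModule hΛ hL hproj
      refine ⟨α, ?_⟩
      rw [coe_ideleToClassGroup]
      exact congrArg (· - _) (G0.cls_eq_of_isomorphic hL.isLF0 _ hα).symm
    | zero => exact ⟨1, by rw [map_one]; rfl⟩
    | add x y _ _ hx hy =>
      obtain ⟨α, rfl⟩ := hx
      obtain ⟨β, rfl⟩ := hy
      exact ⟨α * β, by rw [map_mul]; rfl⟩
    | neg x _ hx =>
      obtain ⟨α, rfl⟩ := hx
      exact ⟨α⁻¹, by rw [map_inv]; rfl⟩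
  intro x
  obtain ⟨α, hα⟩ := key _ x.toAdd.2
  exact ⟨α, congrArg Multiplicative.ofAdd (Subtype.ext hα)⟩

lemma ideleToClassGroup_unitIdeles {u : ideleGroup D Λ} (hu : u ∈ unitIdeles D Λ) :
    ideleToClassGroup hΛ u = 1 := by
  refine congrArg Multiplicative.ofAdd (Subtype.ext ?_)
  change ideleCls hΛ u - _ = 0
  rw [← ideleCls_one, sub_eq_zero]
  refine ideleCls_eq_of_isomorphic hΛ
    (isomorphic_ideleModule_of_mem_units hΛ u 1 1 (one_mem _) fun 𝔭 => ?_)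
  have h1 : (1 : ideleGroup D Λ).1 𝔭 = 1 := rfl
  rw [h1, map_one, mul_one, inv_one, mul_one]
  exact hu 𝔭

lemma ideleToClassGroup_principalIdeles {x : ideleGroup D Λ} (hx : x ∈ principalIdeles D Λ) :
    ideleToClassGroup hΛ x = 1 := by
  obtain ⟨y, hy, h⟩ := hx
  have hxy : x = 1 * principalIdele hΛ y hy := by
    rw [one_mul]
    exact Subtype.ext (funext h)
  refine congrArg Multiplicative.ofAdd (Subtype.ext ?_)
  change ideleCls hΛ x - _ = 0
  rw [hxy, ideleCls_mul_principalIdele, ideleCls_one, sub_self]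

end ClassGroup

theorem mainTheorem2 {R : Type u} {K : Type v} {A : Type w}
    [CommRing R] [IsDedekindDomain R] [Field K] [Algebra R K] [IsFractionRing R K]
    [Ring A] [IsSemisimpleRing A] [Algebra K A] [Algebra R A] [IsScalarTower R K A]
    (D : DGAlgebra K A) (Λ : Subalgebra R A) (hΛ : IsDGOrder D Λ) :
    ∃ hLF : ∀ α : ideleGroup D Λ, (ideleModule hΛ α).IsLocallyFreeRankOne,
      (∀ α β : ideleGroup D Λ,
        G0.cls (ideleModule hΛ α) (hLF α).isLF0 + G0.cls (ideleModule hΛ β) (hLF β).isLF0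
            - 2 • G0.regularCls hΛ.toDGAlgebra =
          G0.cls (ideleModule hΛ (α * β)) (hLF (α * β)).isLF0
            - G0.regularCls hΛ.toDGAlgebra) ∧
      ∃ Φ : ideleGroup D Λ →* Multiplicative (DGClassGroup hΛ.toDGAlgebra),
        (∀ α : ideleGroup D Λ, ((Φ α).toAdd : G0 hΛ.toDGAlgebra) =
          G0.cls (ideleModule hΛ α) (hLF α).isLF0 - G0.regularCls hΛ.toDGAlgebra) ∧
        Function.Surjective Φ ∧
        ∃ Ψ : IdeleDoubleCosets D Λ → DGClassGroup hΛ.toDGAlgebra,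
          ∀ α : ideleGroup D Λ,
            Ψ (DoubleCoset.mk (unitIdeles D Λ) (principalIdeles D Λ) α) = (Φ α).toAdd := by
  refine ⟨isLocallyFreeRankOne_ideleModule hΛ, fun α β => ?_, ideleToClassGroup hΛ,
    coe_ideleToClassGroup hΛ, ideleToClassGroup_surjective hΛ,
    fun q => (ideleToClassGroup hΛ q.out).toAdd, fun α => ?_⟩
  · change ideleCls hΛ α + ideleCls hΛ β - 2 • G0.regularCls hΛ.toDGAlgebra =
      ideleCls hΛ (α * β) - G0.regularCls hΛ.toDGAlgebra
    rw [ideleCls_add_sub, two_nsmul, sub_add_sub_comm]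
  -- The map on double cosets is evaluated at a chosen representative, which has the form `u α x`
  -- with `u` and `x` in the kernel.
  · obtain ⟨u, x, hu, hx, h⟩ :=
      DoubleCoset.mk_out_eq_mul (unitIdeles D Λ) (principalIdeles D Λ) α
    refine congrArg Multiplicative.toAdd ((congrArg (ideleToClassGroup hΛ) h).trans ?_)
    rw [map_mul, map_mul, ideleToClassGroup_unitIdeles hΛ hu,
      ideleToClassGroup_principalIdeles hΛ hx, one_mul, mul_one]
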